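/- Let $G$ be a countable group with unit $e$, let $X$ be a locally compact Hausdorff space, and let $(\{X_t\}_{t\in G},\{h_t\}_{t\in G})$ be a partial action of $G$ on $X$: each $X_t\subseteq X$ is open, each $h_t:X_{t^{-1}}\to X_t$ is a homeomorphism, $X_e=X$ and $h_e=\mathrm{id}_X$, $h_t(X_{t^{-1}}\cap X_s)=X_t\cap X_{ts}$, and $h_t(h_s(x))=h_{ts}(x)$ for $x\in X_{s^{-1}}\cap X_{s^{-1}t^{-1}}$. Assume that the partial action is free ($x\in X_{t^{-1}}$ and $h_t(x)=x$ imply $t=e$) and that every $X_t$ is $\sigma$-compact (in particular $X=X_e$ is). Let $C_0(X_t)\subseteq C_0(X)$ be the ideal of functions vanishing off $X_t$, and let $\alpha_t:C_0(X_{t^{-1}})\to C_0(X_t)$, $\alpha_t(f)=f\circ h_t^{-1}$. Let $\mathcal L$ be the $*$-algebra of finite sums $\sum_{t\in G}a_t\delta_t$ with $a_t\in C_0(X_t)$, with $$(a*b)_\gamma=\sum_{t\in G}\alpha_t\bigl(\alpha_{t^{-1}}(a_t)\,b_{t^{-1}\gamma}\bigr),\qquad (a^*)_\gamma=\alpha_\gamma\bigl(\overline{a_{\gamma^{-1}}}\bigr),\qquad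 \|a\|_1=\sum_{t\in G}\|a_t\|_\infty .$$ The partial crossed product $C_0(X)\rtimes_\alpha G$ (which is $C(X)\rtimes_\alpha G$ if $X$ is compact) is the enveloping C*-algebra of $\mathcal L$, that is, its Hausdorff completion in the seminorm $a\mapsto\sup_\pi\|\pi(a)\|$, where $\pi$ runs over the $*$-representations of $\mathcal L$ on Hilbert spaces with $\|\pi(b)\|\le\|b\|_1$ for all $b\in\mathcal L$. Let $R=\{(x,h_t(x)) : t\in G,\ x\in X_{t^{-1}}\}\subseteq X\times X$ be the orbit equivalence relation, with the topology induced by the injective map $(x,h_t(x))\mapsto(x,t)$ from $X\times G$, where $G$ is discrete; this is an étale equivalence relation. Let $C_c(R)$ be the $*$-algebra of compactly supported continuous functions on $R$, with $$(f*g)(x,z)=\sum_{y\in[x]}f(x,y)\,g(y,z),\qquad f^*(x,y)=\overline{f(y,x)},$$ where $[x]$ is the equivalence class of $x$. The full groupoid C*-algebra $C^*(R)$ is the completion of $C_c(R)$ in the norm $f\mapsto\sup_\pi\|\pi(f)\|$, where $\pi$ runs over the $*$-representations of $C_c(R)$ on Hilbert spaces with $\|\pi(g)\|\le\|g\|_I$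 for all $g\in C_c(R)$, and $\|g\|_I=\max\bigl\{\sup_x\sum_{y\in[x]}|g(x,y)|,\ \sup_y\sum_{x\in[y]}|g(x,y)|\bigr\}$. Then $C_0(X)\rtimes_\alpha G$ and $C^*(R)$ are isomorphic as C*-algebras. -/

import Mathlib

open scoped ENNReal ZeroAtInfty CompactlySupported

universe u v w

/-- A representation of the complex `*`-algebra `B` on a Hilbert space (in the universe `w`) which
is bounded by the function `N` (in the applications, `N` is a norm on `B`). -/
structure BoundedRep (B : Type u) [NonUnitalNonAssocRing B] [Module ℂ B] [Star B] (N : B → ℝ) where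
  /-- the Hilbert space -/
  H : Type w
  [normedAddCommGroup : NormedAddCommGroup H]
  [innerProductSpace : InnerProductSpace ℂ H]
  [completeSpace : CompleteSpace H]
  /-- the representation, a multiplicative, `*`-preserving, linear map -/
  π : B →⋆ₙₐ[ℂ] (H →L[ℂ] H)
  bound : ∀ b, ‖π b‖ ≤ N b

namespace BoundedRep

attribute [instance] BoundedRep.normedAddCommGroup BoundedRep.innerProductSpace
  BoundedRep.completeSpace

end BoundedRep

section Envelope

variable (B : Type u) [NonUnitalNonAssocRing B] [Module ℂ B] [Star B] (N : B → ℝ)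

/-- The C*-algebra of bounded families `(T_ρ)_ρ` of operators `T_ρ ∈ B(H_ρ)`, where `ρ` runs over
all the representations of `B` bounded by `N`, with the norm `sup_ρ ‖T_ρ‖`. -/
def RepProduct : Type (max u (w + 1)) :=
  lp (fun ρ : BoundedRep.{u, w} B N => (ρ.H →L[ℂ] ρ.H)) ∞

noncomputable instance : NonUnitalCStarAlgebra (RepProduct.{u, w} B N) :=
  inferInstanceAs
    (NonUnitalCStarAlgebra (lp (fun ρ : BoundedRep.{u, w} B N => (ρ.H →L[ℂ] ρ.H)) ∞))

/-- The direct sum of all the representations of `B` that are bounded by `N`. -/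
noncomputable def universalRep : B →⋆ₙₐ[ℂ] RepProduct.{u, w} B N where
  toFun b := ⟨fun ρ => ρ.π b, memℓp_infty ⟨N b, by rintro _ ⟨ρ, rfl⟩; exact ρ.bound b⟩⟩
  map_smul' c b := Subtype.ext (funext fun ρ => map_smul ρ.π c b)
  map_zero' := Subtype.ext (funext fun ρ => map_zero ρ.π)
  map_add' a b := Subtype.ext (funext fun ρ => map_add ρ.π a b)
  map_mul' a b := Subtype.ext (funext fun ρ => map_mul ρ.π a b)
  map_star' b := Subtype.ext (funext fun ρ => map_star ρ.π b)

/-- The image of the direct sum of all the representations of `B` that are bounded by `N`, closed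
in norm. -/
noncomputable def envelopingSubalgebra : NonUnitalStarSubalgebra ℂ (RepProduct.{u, w} B N) :=
  (NonUnitalStarAlgHom.range (universalRep.{u, w} B N)).topologicalClosure

instance : IsClosed (envelopingSubalgebra.{u, w} B N : Set (RepProduct.{u, w} B N)) :=
  NonUnitalStarSubalgebra.isClosed_topologicalClosure _

/-- The enveloping C*-algebra of the `*`-algebra `B` with norm `N`, that is, the Hausdorff
completion of `B` in the C*-seminorm `b ↦ sup_ρ ‖ρ b‖`, where `ρ` runs over the representations of
`B` on Hilbert spaces with `‖ρ b‖ ≤ N b` for all `b`. It is realized as the norm closure of the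
image of `B` under the direct sum of all these representations. The Hilbert spaces are taken in the
universe `w`; if `w` is at least the universe of `B`, then they include, up to unitary equivalence,
all the cyclic ones, and the supremum does not depend on `w`. -/
def EnvelopingCStarAlgebra : Type (max u (w + 1)) := envelopingSubalgebra.{u, w} B N

noncomputable instance : NonUnitalCStarAlgebra (EnvelopingCStarAlgebra.{u, w} B N) :=
  inferInstanceAs (NonUnitalCStarAlgebra (envelopingSubalgebra.{u, w} B N))

/-- The canonical map of `B` to its enveloping C*-algebra. -/
noncomputable def toEnvelope (b : B) : EnvelopingCStarAlgebra.{u, w} B N :=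
  ⟨universalRep B N b, subset_closure ⟨b, rfl⟩⟩

theorem denseRange_toEnvelope : DenseRange (toEnvelope.{u, w} B N) := fun x => by
  refine (closure_subtype (s := Set.range (toEnvelope.{u, w} B N))).2 (closure_mono ?_ x.2)
  rintro _ ⟨b, rfl⟩
  exact ⟨_, ⟨b, rfl⟩, rfl⟩

theorem norm_toEnvelope (b : B) :
    ‖toEnvelope.{u, w} B N b‖ = ⨆ ρ : BoundedRep.{u, w} B N, ‖ρ.π b‖ :=
  lp.norm_eq_ciSup (universalRep.{u, w} B N b)

end Envelope

/-- A partial action of the group `G` on the C*-algebra `A`: closed two-sided ideals `D t` (these are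
automatically `*`-subalgebras) and `*`-isomorphisms `α t` of `D t⁻¹` onto `D t`, subject to the
axioms of a partial action. -/
structure CStarPartialAction (G : Type v) [Group G] (A : Type u) [NonUnitalCStarAlgebra A] where
  /-- the ideals -/
  D : G → NonUnitalStarSubalgebra ℂ A
  isClosed : ∀ t, IsClosed (D t : Set A)
  mul_mem_left : ∀ (t : G) (a x : A), x ∈ D t → a * x ∈ D t
  mul_mem_right : ∀ (t : G) (a x : A), x ∈ D t → x * a ∈ D t
  /-- the isomorphisms -/
  α : ∀ t, D t⁻¹ ≃⋆ₐ[ℂ] D t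
  D_one : D 1 = ⊤
  α_one : ∀ x : D (1 : G)⁻¹, (α 1 x : A) = x
  α_image : ∀ t s : G,
    (fun x : D t⁻¹ => (α t x : A)) '' {x | (x : A) ∈ D s} = (D t : Set A) ∩ D (t * s)
  α_comp : ∀ (t s : G) (x : A) (hs : x ∈ D s⁻¹) (hts : x ∈ D (t * s)⁻¹)
    (ht : (α s ⟨x, hs⟩ : A) ∈ D t⁻¹), (α t ⟨α s ⟨x, hs⟩, ht⟩ : A) = α (t * s) ⟨x, hts⟩

namespace CStarPartialAction

variable {G : Type v} [Group G] {A : Type u} [NonUnitalCStarAlgebra A]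
  (Θ : CStarPartialAction G A)

/-- The coefficient of the product `(x δ_t) * (y δ_s)`, that is, `α_t (α_{t⁻¹} (x) y) ∈ D (t * s)`
(where `α_{t⁻¹}` is the inverse of `α_t`). -/
noncomputable def mulCoeff (t s : G) (x : Θ.D t) (y : Θ.D s) : Θ.D (t * s) :=
  ⟨Θ.α t ⟨((Θ.α t).symm x : A) * y, Θ.mul_mem_right _ _ _ ((Θ.α t).symm x).2⟩,
    ((Θ.α_image t s).subset
      ⟨⟨((Θ.α t).symm x : A) * y, Θ.mul_mem_right _ _ _ ((Θ.α t).symm x).2⟩,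
        Θ.mul_mem_left _ _ _ y.2, rfl⟩).2⟩

/-- `mulCoeff` as a bilinear map. -/
noncomputable def mulCoeffₗ (t s : G) : Θ.D t →ₗ[ℂ] Θ.D s →ₗ[ℂ] Θ.D (t * s) :=
  LinearMap.mk₂ ℂ (Θ.mulCoeff t s)
    (fun x x' y => Subtype.ext <| by
      rw [NonUnitalStarSubalgebra.coe_add]
      simp only [mulCoeff]
      rw [← NonUnitalStarSubalgebra.coe_add, ← map_add]
      congr 2
      apply Subtype.ext
      simp [add_mul])
    (fun c x y => Subtype.ext <| by
      rw [NonUnitalStarSubalgebra.coe_smul]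
      simp only [mulCoeff]
      rw [← NonUnitalStarSubalgebra.coe_smul, ← map_smul]
      congr 2
      apply Subtype.ext
      simp [smul_mul_assoc])
    (fun x y y' => Subtype.ext <| by
      rw [NonUnitalStarSubalgebra.coe_add]
      simp only [mulCoeff]
      rw [← NonUnitalStarSubalgebra.coe_add, ← map_add]
      congr 2
      apply Subtype.ext
      simp [mul_add])
    (fun c x y => Subtype.ext <| by
      rw [NonUnitalStarSubalgebra.coe_smul]
      simp only [mulCoeff]
      rw [← NonUnitalStarSubalgebra.coe_smul, ← map_smul]
      congr 2
      apply Subtype.ext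
      simp [mul_smul_comm])

open Classical in
/-- The bilinear extension of `(x δ_t) * (y δ_s) = α_t (α_{t⁻¹} (x) y) δ_{ts}` to finite sums. -/
noncomputable def mulₗ : (Π₀ t : G, Θ.D t) →ₗ[ℂ] (Π₀ t : G, Θ.D t) →ₗ[ℂ] (Π₀ t : G, Θ.D t) :=
  DFinsupp.lsum ℂ fun t => LinearMap.flip <| DFinsupp.lsum ℂ fun s =>
    ((Θ.mulCoeffₗ t s).compr₂ (DFinsupp.lsingle (R := ℂ) (M := fun r => Θ.D r) (t * s))).flip

open Classical in
theorem mulₗ_single (t s : G) (x : Θ.D t) (y : Θ.D s) :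
    Θ.mulₗ (DFinsupp.single t x) (DFinsupp.single s y) =
      DFinsupp.single (t * s) (Θ.mulCoeff t s x y) := by
  rw [mulₗ, DFinsupp.lsum_single, LinearMap.flip_apply, DFinsupp.lsum_single]
  rfl

/-- The algebra `𝓛` of the finite sums `∑ a_t δ_t` with `a_t ∈ D t`. -/
def FinSums : Type (max u v) := Π₀ t : G, Θ.D t

namespace FinSums

noncomputable instance : AddCommGroup Θ.FinSums := inferInstanceAs (AddCommGroup (Π₀ t, Θ.D t))

noncomputable instance : Module ℂ Θ.FinSums := inferInstanceAs (Module ℂ (Π₀ t, Θ.D t))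

variable {Θ}

/-- The coefficient `a_t` of an element of `𝓛`. -/
def coeff (a : Θ.FinSums) (t : G) : Θ.D t := DFinsupp.toFun a t

theorem ext {a b : Θ.FinSums} (h : ∀ t, a.coeff t = b.coeff t) : a = b := DFinsupp.ext h

variable (Θ) in
open Classical in
/-- The element `x δ_t` of `𝓛`. -/
noncomputable def single (t : G) : Θ.D t →ₗ[ℂ] Θ.FinSums :=
  DFinsupp.lsingle (R := ℂ) (M := fun t => Θ.D t) t

/-- The product of `𝓛` is the bilinear extension of
`(x δ_t) * (y δ_s) = α_t (α_{t⁻¹} (x) y) δ_{ts}`. -/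
noncomputable instance : NonUnitalNonAssocRing Θ.FinSums :=
  { (inferInstance : AddCommGroup Θ.FinSums) with
    mul := fun a b => Θ.mulₗ a b
    left_distrib := fun a b c => map_add (Θ.mulₗ a) b c
    right_distrib := fun a b c => LinearMap.map_add₂ Θ.mulₗ a b c
    zero_mul := fun a => LinearMap.map_zero₂ Θ.mulₗ a
    mul_zero := fun a => map_zero (Θ.mulₗ a) }

theorem single_mul_single (t s : G) (x : Θ.D t) (y : Θ.D s) :
    single Θ t x * single Θ s y = single Θ (t * s) (Θ.mulCoeff t s x y) := by
  classical
  exact Θ.mulₗ_single t s x y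

theorem coeff_single_self (t : G) (x : Θ.D t) : (single Θ t x).coeff t = x := by
  classical
  exact DFinsupp.single_eq_same

theorem coeff_single_of_ne {t s : G} (h : s ≠ t) (x : Θ.D t) : (single Θ t x).coeff s = 0 := by
  classical
  exact DFinsupp.single_eq_of_ne h

theorem finite_support_coeff (a : Θ.FinSums) : {t | a.coeff t ≠ 0}.Finite := by
  classical
  exact DFinsupp.finite_support (a : Π₀ t, Θ.D t)

theorem induction_on {p : Θ.FinSums → Prop} (a : Θ.FinSums) (h0 : p 0)
    (hs : ∀ t x, p (single Θ t x)) (hadd : ∀ a b, p a → p b → p (a + b)) : p a := by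
  classical
  exact DFinsupp.induction (p := p) a h0 fun t x f _ _ hf => hadd _ _ (hs t x) hf

/-- The product of `𝓛` in terms of coefficients,
`(a * b)_γ = ∑_t α_t (α_{t⁻¹} (a_t) b_{t⁻¹ γ})` (a finite sum). -/
theorem coeff_mul (a b : Θ.FinSums) (γ : G) : ((a * b).coeff γ : A) =
    ∑ᶠ t, (Θ.mulCoeff t (t⁻¹ * γ) (a.coeff t) (b.coeff (t⁻¹ * γ)) : A) := by
  have z1 : ∀ t s (y : Θ.D s), Θ.mulCoeff t s 0 y = 0 := fun t s y =>
    LinearMap.map_zero₂ (Θ.mulCoeffₗ t s) y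
  have z2 : ∀ t s (x : Θ.D t), Θ.mulCoeff t s x 0 = 0 := fun t s x =>
    map_zero (Θ.mulCoeffₗ t s x)
  have a1 : ∀ t s x x' (y : Θ.D s),
      Θ.mulCoeff t s (x + x') y = Θ.mulCoeff t s x y + Θ.mulCoeff t s x' y :=
    fun t s x x' y => LinearMap.map_add₂ (Θ.mulCoeffₗ t s) x x' y
  have a2 : ∀ t s (x : Θ.D t) y y',
      Θ.mulCoeff t s x (y + y') = Θ.mulCoeff t s x y + Θ.mulCoeff t s x y' :=
    fun t s x y y' => map_add (Θ.mulCoeffₗ t s x) y y'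
  have c0 : ∀ t, (0 : Θ.FinSums).coeff t = 0 := fun t => rfl
  have cadd : ∀ (a b : Θ.FinSums) t, (a + b).coeff t = a.coeff t + b.coeff t := fun a b t =>
    DFinsupp.add_apply (a : Π₀ t, Θ.D t) b t
  have fin : ∀ a b : Θ.FinSums, (Function.support fun t =>
      (Θ.mulCoeff t (t⁻¹ * γ) (a.coeff t) (b.coeff (t⁻¹ * γ)) : A)).Finite := fun a b =>
    a.finite_support_coeff.subset fun t ht h => ht (by
      change a.coeff t = 0 at h
      simp only [h, z1]; rfl)
  induction a using induction_on with
  | h0 => simp [c0, z1]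
  | hadd a a' ha ha' =>
    rw [add_mul, cadd, NonUnitalStarSubalgebra.coe_add, ha, ha',
      ← finsum_add_distrib (fin a b) (fin a' b)]
    simp only [cadd, a1, NonUnitalStarSubalgebra.coe_add]
  | hs t x =>
    induction b using induction_on with
    | h0 => simp [c0, z2]
    | hadd b b' hb hb' =>
      rw [mul_add, cadd, NonUnitalStarSubalgebra.coe_add, hb, hb',
        ← finsum_add_distrib (fin _ b) (fin _ b')]
      simp only [cadd, a2, NonUnitalStarSubalgebra.coe_add]
    | hs s y =>
      rw [single_mul_single, finsum_eq_single _ t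
        (fun r hr => by rw [coeff_single_of_ne hr, z1]; rfl), coeff_single_self]
      by_cases h : γ = t * s
      · subst h
        rw [coeff_single_self]
        have key : ∀ r, r = s → ((Θ.mulCoeff t s x y : Θ.D (t * s)) : A) =
            Θ.mulCoeff t r x ((single Θ s y).coeff r) := by
          rintro r rfl
          rw [coeff_single_self]
        exact key _ (by group)
      · rw [coeff_single_of_ne h, coeff_single_of_ne, z2]
        · rfl
        · rintro rfl
          exact h (by group)

/-- The involution of `𝓛`, `(a^*)_γ = α_γ ((a_{γ⁻¹})^*)`. -/
noncomputable instance : Star Θ.FinSums where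
  star a := DFinsupp.mapRange (fun γ (x : Θ.D γ⁻¹) => Θ.α γ (star x)) (fun γ => by simp)
    (DFinsupp.comapDomain (β := fun t => Θ.D t) (fun t : G => t⁻¹) inv_injective a)

theorem coeff_star (a : Θ.FinSums) (γ : G) : (star a).coeff γ = Θ.α γ (star (a.coeff γ⁻¹)) := rfl

/-- The `ℓ¹`-norm on `𝓛`, `‖a‖ = ∑_t ‖a_t‖` (a finite sum). -/
noncomputable def l1Norm (a : Θ.FinSums) : ℝ := ∑ᶠ t, ‖(a.coeff t : A)‖

end FinSums

/-- The partial crossed product, the enveloping C*-algebra of `𝓛` with the `ℓ¹`-norm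
(representations are on Hilbert spaces in the universe `w`). -/
abbrev CrossedProduct : Type (max u v (w + 1)) :=
  EnvelopingCStarAlgebra.{max u v, w} Θ.FinSums FinSums.l1Norm

end CStarPartialAction

section PushForward

variable {X : Type u} [TopologicalSpace X]

/-- The ideal `C₀(U)` of `C₀(X)`, for an open set `U`: the functions in `C₀(X)` that vanish
outside of `U`. -/
def c0Ideal (U : Set X) : NonUnitalStarSubalgebra ℂ C₀(X, ℂ) where
  carrier := {f | ∀ x, x ∉ U → f x = 0}
  add_mem' := fun {f g} hf hg x hx => by simp [hf x hx, hg x hx]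
  zero_mem' := fun x _ => rfl
  mul_mem' := fun {f g} hf hg x hx => by simp [hf x hx]
  smul_mem' := fun c f hf x hx => by simp [hf x hx]
  star_mem' := fun {f} hf x hx => by simp [hf x hx]

theorem mem_c0Ideal {U : Set X} {f : C₀(X, ℂ)} : f ∈ c0Ideal U ↔ ∀ x, x ∉ U → f x = 0 := Iff.rfl

theorem exists_compact_of_mem_c0Ideal [T2Space X] (e : OpenPartialHomeomorph X X) {U V : Set X}
    (hU : e.source = U) (hV : e.target = V) (f : c0Ideal U) {ε : ℝ} (hε : 0 < ε) :
    ∃ K : Set X, IsCompact K ∧ K ⊆ V ∧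
      ∀ x, x ∉ K → ‖V.indicator (fun x => f.1 (e.symm x)) x‖ < ε := by
  subst hU hV
  obtain ⟨f, hf⟩ := f
  have h1 : ∀ᶠ x in Filter.cocompact X, ‖f x‖ < ε := by
    have := (zero_at_infty f).norm
    rw [norm_zero] at this
    exact this.eventually_lt_const hε
  obtain ⟨T, hT, hTs⟩ := Filter.mem_cocompact.1 h1
  have hK : IsCompact {x | ε ≤ ‖f x‖} := by
    refine hT.of_isClosed_subset (isClosed_le continuous_const (map_continuous f).norm) ?_
    intro x hx
    by_contra hxT
    have h2 : ‖f x‖ < ε := hTs hxT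
    exact absurd h2 (not_lt.2 hx)
  have hKs : {x | ε ≤ ‖f x‖} ⊆ e.source := by
    intro x hx
    by_contra hxs
    have hx' : ε ≤ ‖f x‖ := hx
    rw [hf x hxs, norm_zero] at hx'
    exact absurd hx' (not_le.2 hε)
  refine ⟨e '' {x | ε ≤ ‖f x‖}, hK.image_of_continuousOn (e.continuousOn.mono hKs), ?_, ?_⟩
  · rintro _ ⟨x, hx, rfl⟩
    exact e.map_source (hKs hx)
  · intro x hx
    by_cases hxt : x ∈ e.target
    · rw [Set.indicator_of_mem hxt]
      by_contra h
      exact hx ⟨e.symm x, not_lt.1 h, e.right_inv hxt⟩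
    · rw [Set.indicator_of_notMem hxt, norm_zero]
      exact hε

/-- For a homeomorphism `e` of an open set `U` onto an open set `V` and `f ∈ C₀(U)`, the function
`f ∘ e⁻¹ ∈ C₀(V)` (extended by zero). -/
noncomputable def c0Push [T2Space X] (e : OpenPartialHomeomorph X X) {U V : Set X}
    (hU : e.source = U) (hV : e.target = V) (f : c0Ideal U) : c0Ideal V :=
  ⟨{ toFun := V.indicator fun x => f.1 (e.symm x)
     continuous_toFun := by
      rw [continuous_iff_continuousAt]
      intro x
      by_cases hx : x ∈ V
      · have : ContinuousAt (fun x => f.1 (e.symm x)) x :=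
          ContinuousAt.comp (map_continuous f.1).continuousAt (e.continuousAt_symm (hV ▸ hx))
        refine this.congr ?_
        filter_upwards [(hV ▸ e.open_target : IsOpen V).mem_nhds hx] with y hy
        rw [Set.indicator_of_mem hy]
      · rw [ContinuousAt, Set.indicator_of_notMem hx, Metric.tendsto_nhds]
        intro ε hε
        obtain ⟨K, hK, hKt, h⟩ := exists_compact_of_mem_c0Ideal e hU hV f hε
        filter_upwards [hK.isClosed.isOpen_compl.mem_nhds fun hxK => hx (hKt hxK)] with y hy
        rw [dist_zero_right]
        exact h y hy
     zero_at_infty' := by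
      rw [Metric.tendsto_nhds]
      intro ε hε
      obtain ⟨K, hK, -, h⟩ := exists_compact_of_mem_c0Ideal e hU hV f hε
      filter_upwards [hK.compl_mem_cocompact] with y hy
      rw [dist_zero_right]
      exact h y hy },
    fun x hx => Set.indicator_of_notMem (f := fun x => f.1 (e.symm x)) hx⟩

theorem c0Push_apply [T2Space X] (e : OpenPartialHomeomorph X X) {U V : Set X}
    (hU : e.source = U) (hV : e.target = V) (f : c0Ideal U) {x : X} (hx : x ∈ V) :
    (c0Push e hU hV f).1 x = f.1 (e.symm x) :=
  Set.indicator_of_mem (f := fun x => f.1 (e.symm x)) hx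

theorem c0Ideal_ext {U : Set X} {f g : c0Ideal U} (h : ∀ x ∈ U, f.1 x = g.1 x) : f = g := by
  refine Subtype.ext (DFunLike.ext _ _ fun x => ?_)
  by_cases hx : x ∈ U
  · exact h x hx
  · rw [f.2 x hx, g.2 x hx]

/-- The `*`-isomorphism `f ↦ f ∘ e⁻¹` of `C₀(U)` onto `C₀(V)`, for a homeomorphism `e` of `U`
onto `V`. -/
noncomputable def c0PushEquiv [T2Space X] (e : OpenPartialHomeomorph X X) {U V : Set X}
    (hU : e.source = U) (hV : e.target = V) : c0Ideal U ≃⋆ₐ[ℂ] c0Ideal V where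
  toFun := c0Push e hU hV
  invFun := c0Push e.symm hV hU
  left_inv f := c0Ideal_ext fun x hx => by
    rw [c0Push_apply e.symm hV hU _ hx, e.symm_symm,
      c0Push_apply e hU hV _ (hV ▸ e.map_source (hU ▸ hx)), e.left_inv (hU ▸ hx)]
  right_inv f := c0Ideal_ext fun x hx => by
    rw [c0Push_apply e hU hV _ hx, c0Push_apply e.symm hV hU _ (hU ▸ e.map_target (hV ▸ hx)),
      e.symm_symm, e.right_inv (hV ▸ hx)]
  map_mul' f g := c0Ideal_ext fun x hx => by
    rw [c0Push_apply e hU hV _ hx]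
    change _ = (c0Push e hU hV f).1 x * (c0Push e hU hV g).1 x
    rw [c0Push_apply e hU hV _ hx, c0Push_apply e hU hV _ hx]
    rfl
  map_add' f g := c0Ideal_ext fun x hx => by
    rw [c0Push_apply e hU hV _ hx]
    change _ = (c0Push e hU hV f).1 x + (c0Push e hU hV g).1 x
    rw [c0Push_apply e hU hV _ hx, c0Push_apply e hU hV _ hx]
    rfl
  map_star' f := c0Ideal_ext fun x hx => by
    rw [c0Push_apply e hU hV _ hx]
    change _ = star ((c0Push e hU hV f).1 x)
    rw [c0Push_apply e hU hV _ hx]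
    rfl
  map_smul' c f := c0Ideal_ext fun x hx => by
    rw [c0Push_apply e hU hV _ hx]
    change _ = c • ((c0Push e hU hV f).1 x)
    rw [c0Push_apply e hU hV _ hx]
    rfl

end PushForward

/-- A partial action of the group `G` on the topological space `X`: open sets `X_t = dom t` and
homeomorphisms `h_t` of `X_{t⁻¹}` onto `X_t`. -/
structure PartialAction (G : Type v) [Group G] (X : Type u) [TopologicalSpace X] where
  /-- the open sets `X_t` -/
  dom : G → Set X
  /-- the homeomorphisms; only the restriction of `h t` to `dom t⁻¹` has a meaning -/
  h : G → OpenPartialHomeomorph X X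
  source_eq : ∀ t, (h t).source = dom t⁻¹
  target_eq : ∀ t, (h t).target = dom t
  dom_one : dom 1 = Set.univ
  h_one : ∀ x, h 1 x = x
  image_eq : ∀ t s, h t '' (dom t⁻¹ ∩ dom s) = dom t ∩ dom (t * s)
  h_comp : ∀ t s, ∀ x ∈ dom s⁻¹ ∩ dom (s⁻¹ * t⁻¹), h t (h s x) = h (t * s) x

namespace PartialAction

variable {G : Type v} [Group G] {X : Type u} [TopologicalSpace X] (θ : PartialAction G X)

/-- A partial action is free if `h_t x = x` only for `t = 1`. -/
def IsFree : Prop := ∀ t, ∀ x ∈ θ.dom t⁻¹, θ.h t x = x → t = 1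

theorem isOpen_dom (t : G) : IsOpen (θ.dom t) := θ.target_eq t ▸ (θ.h t).open_target

theorem map_mem {t : G} {x : X} (hx : x ∈ θ.dom t⁻¹) : θ.h t x ∈ θ.dom t := by
  rw [← θ.target_eq]
  exact (θ.h t).map_source (by rwa [θ.source_eq])

theorem map_mem_mul {t s : G} {x : X} (hx : x ∈ θ.dom t⁻¹) (hs : x ∈ θ.dom s) :
    θ.h t x ∈ θ.dom (t * s) :=
  ((θ.image_eq t s).subset ⟨x, ⟨hx, hs⟩, rfl⟩).2

theorem inv_apply {t : G} {x : X} (hx : x ∈ θ.dom t⁻¹) : θ.h t⁻¹ (θ.h t x) = x := by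
  rw [θ.h_comp t⁻¹ t x ⟨hx, by simp [θ.dom_one]⟩, inv_mul_cancel, θ.h_one]

theorem symm_apply {t : G} {x : X} (hx : x ∈ θ.dom t) : (θ.h t).symm x = θ.h t⁻¹ x := by
  have hx' : x ∈ (θ.h t).target := by rwa [θ.target_eq]
  have h1 := θ.inv_apply (t := t) (x := (θ.h t).symm x)
    (by rw [← θ.source_eq]; exact (θ.h t).map_target hx')
  rw [(θ.h t).right_inv hx'] at h1
  exact h1.symm

theorem mem_inv_of_mem_mul {t s : G} {x : X} (hx : x ∈ θ.dom t⁻¹)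
    (hs : θ.h t x ∈ θ.dom (t * s)) : x ∈ θ.dom s := by
  have := θ.map_mem_mul (t := t⁻¹) (s := t * s) (x := θ.h t x) (by simpa using θ.map_mem hx) hs
  rwa [θ.inv_apply hx, inv_mul_cancel_left] at this

/-- The partial action on `C₀(X)` that corresponds to a partial action on `X`, given by
`α_t : C₀(X_{t⁻¹}) → C₀(X_t)`, `α_t f = f ∘ h_t⁻¹`. -/
noncomputable def c0Action [T2Space X] : CStarPartialAction G C₀(X, ℂ) where
  D t := c0Ideal (θ.dom t)
  isClosed t := by
    have : ((c0Ideal (θ.dom t) : NonUnitalStarSubalgebra ℂ C₀(X, ℂ)) : Set C₀(X, ℂ)) =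
        ⋂ x, ⋂ (_ : x ∉ θ.dom t), {f | f x = 0} := by
      ext f
      simp [mem_c0Ideal]
    rw [this]
    refine isClosed_iInter fun x => isClosed_iInter fun _ => isClosed_eq ?_ continuous_const
    exact (continuous_eval_const (F := BoundedContinuousFunction X ℂ) x).comp
      (ZeroAtInftyContinuousMap.isometry_toBCF (α := X) (β := ℂ)).continuous
  mul_mem_left t a f hf x hx := by simp [hf x hx]
  mul_mem_right t a f hf x hx := by simp [hf x hx]
  α t := c0PushEquiv (θ.h t) (θ.source_eq t) (θ.target_eq t)
  D_one := by
    ext f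
    simp [mem_c0Ideal, θ.dom_one]
  α_one f := by
    ext x
    have hx : x ∈ θ.dom 1 := by simp [θ.dom_one]
    refine (c0Push_apply (θ.h 1) (θ.source_eq 1) (θ.target_eq 1) f hx).trans ?_
    have : (θ.h 1).symm x = x := by rw [θ.symm_apply hx, inv_one, θ.h_one]
    rw [this]
  α_image t s := by
    ext g
    constructor
    · rintro ⟨f, hf, rfl⟩
      refine ⟨(c0Push (θ.h t) (θ.source_eq t) (θ.target_eq t) f).2, fun x hx => ?_⟩
      by_cases hxt : x ∈ θ.dom t
      · refine (c0Push_apply (θ.h t) (θ.source_eq t) (θ.target_eq t) f hxt).trans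
          (hf _ fun h => hx ?_)
        rw [θ.symm_apply hxt] at h
        have hxt' : x ∈ θ.dom t⁻¹⁻¹ := by simpa using hxt
        exact θ.mem_inv_of_mem_mul hxt' (by simpa using h)
      · exact (c0Push (θ.h t) (θ.source_eq t) (θ.target_eq t) f).2 x hxt
    · rintro ⟨hg, hg'⟩
      refine ⟨(c0PushEquiv (θ.h t) (θ.source_eq t) (θ.target_eq t)).symm ⟨g, hg⟩, fun x hx => ?_,
        ?_⟩
      · by_cases hxt : x ∈ θ.dom t⁻¹
        · refine (c0Push_apply (θ.h t).symm (θ.target_eq t) (θ.source_eq t) ⟨g, hg⟩ hxt).trans ?_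
          exact hg' _ fun h => hx (θ.mem_inv_of_mem_mul hxt h)
        · exact (c0Push (θ.h t).symm (θ.target_eq t) (θ.source_eq t) ⟨g, hg⟩).2 x hxt
      · exact congrArg Subtype.val (StarAlgEquiv.apply_symm_apply
          (c0PushEquiv (θ.h t) (θ.source_eq t) (θ.target_eq t)) ⟨g, hg⟩)
  α_comp t s f hs hts ht := by
    ext x
    set g := c0PushEquiv (θ.h s) (θ.source_eq s) (θ.target_eq s) ⟨f, hs⟩ with hg
    change (c0Push (θ.h t) (θ.source_eq t) (θ.target_eq t) ⟨g, ht⟩).1 x =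
      (c0Push (θ.h (t * s)) (θ.source_eq _) (θ.target_eq _) ⟨f, hts⟩).1 x
    by_cases hxt : x ∈ θ.dom t
    · have hxt' : x ∈ θ.dom t⁻¹⁻¹ := by simpa using hxt
      have hy : (θ.h t).symm x = θ.h t⁻¹ x := θ.symm_apply hxt
      rw [c0Push_apply _ _ _ _ hxt, hy]
      change g.1 (θ.h t⁻¹ x) = _
      by_cases hxs : x ∈ θ.dom (t * s)
      · have hxs' : θ.h t⁻¹ x ∈ θ.dom s := by
          have := θ.map_mem_mul hxt' hxs
          rwa [inv_mul_cancel_left] at this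
        rw [c0Push_apply _ _ _ _ hxs, hg]
        refine (c0Push_apply (θ.h s) (θ.source_eq s) (θ.target_eq s) ⟨f, hs⟩ hxs').trans ?_
        have : (θ.h s).symm (θ.h t⁻¹ x) = (θ.h (t * s)).symm x := by
          rw [θ.symm_apply hxs', θ.symm_apply hxs, mul_inv_rev,
            θ.h_comp _ _ _ ⟨hxt', by simpa using hxs⟩]
        rw [this]
      · rw [(c0Push (θ.h (t * s)) (θ.source_eq _) (θ.target_eq _) ⟨f, hts⟩).2 x hxs]
        refine g.2 _ fun h => hxs ?_
        exact θ.mem_inv_of_mem_mul hxt' (by simpa using h)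
    · rw [(c0Push (θ.h t) (θ.source_eq t) (θ.target_eq t) ⟨g, ht⟩).2 x hxt]
      symm
      by_cases hxs : x ∈ θ.dom (t * s)
      · rw [c0Push_apply _ _ _ _ hxs, θ.symm_apply hxs]
        refine hs _ fun h => hxt ?_
        refine θ.mem_inv_of_mem_mul (t := (t * s)⁻¹) (by simpa using hxs) ?_
        simpa using h
      · exact (c0Push (θ.h (t * s)) (θ.source_eq _) (θ.target_eq _) ⟨f, hts⟩).2 x hxs

end PartialAction

section FiberSums

variable {Y Z M : Type*} [TopologicalSpace Y] [TopologicalSpace Z]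

theorem IsLocalHomeomorph.finite_fiber_inter [T1Space Z] {p : Y → Z} (hp : IsLocalHomeomorph p)
    {K : Set Y} (hK : IsCompact K) (z : Z) : (p ⁻¹' {z} ∩ K).Finite := by
  refine IsCompact.finite (hK.inter_left (isClosed_singleton.preimage hp.continuous)) ?_
  refine (hp.isLocalHomeomorphOn.mono (Set.subset_univ _)).isDiscrete_of_image ?_
  refine Set.Subsingleton.isDiscrete ?_
  rintro _ ⟨y, hy, rfl⟩ _ ⟨y', hy', rfl⟩
  exact hy.1.trans hy'.1.symm

theorem IsLocalHomeomorph.continuous_fiberSum [T2Space Y] [T2Space Z] [AddCommMonoid M]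
    [TopologicalSpace M] [ContinuousAdd M] {p : Y → Z} (hp : IsLocalHomeomorph p) {F : Y → M}
    (hF : Continuous F) (hc : HasCompactSupport F) :
    Continuous fun z => ∑ᶠ y ∈ p ⁻¹' {z}, F y := by
  classical
  rw [continuous_iff_continuousAt]
  intro z₀
  have hS := hp.finite_fiber_inter hc.isCompact z₀
  set S := p ⁻¹' {z₀} ∩ tsupport F with hSdef
  obtain ⟨U, hU, hdisj⟩ := hS.t2_separation
  choose e₀ he₀ hpe₀ using hp
  let e : Y → OpenPartialHomeomorph Y Z := fun y => (e₀ y).restrOpen (U y) (hU y).2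
  have hsrc : ∀ y, (e y).source = (e₀ y).source ∩ U y := fun y => rfl
  have hmem : ∀ y, y ∈ (e y).source := fun y => ⟨he₀ y, (hU y).1⟩
  have hpe : ∀ y, ⇑(e y) = p := fun y => (hpe₀ y).symm
  have hpcont : Continuous p := (show IsLocalHomeomorph p from fun y => ⟨e₀ y, he₀ y, hpe₀ y⟩).continuous
  have hC : IsCompact (p '' (tsupport F \ ⋃ y ∈ S, (e y).source)) :=
    (hc.isCompact.diff (isOpen_biUnion fun y _ => (e y).open_source)).image hpcont
  have hz₀ : z₀ ∉ p '' (tsupport F \ ⋃ y ∈ S, (e y).source) := by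
    rintro ⟨y, ⟨hy, hy'⟩, rfl⟩
    exact hy' (Set.mem_biUnion (show y ∈ S from ⟨rfl, hy⟩) (hmem y))
  have htarget : ∀ y ∈ S, z₀ ∈ (e y).target := fun y hy => by
    have h1 : e y y = z₀ := by rw [hpe]; exact hy.1
    exact h1 ▸ (e y).map_source (hmem y)
  have hW1 : ∀ᶠ z in nhds z₀, ∀ y ∈ S, z ∈ (e y).target :=
    (Filter.eventually_all_finite hS).2 fun y hy => (e y).open_target.mem_nhds (htarget y hy)
  have hW2 : ∀ᶠ z in nhds z₀, z ∉ p '' (tsupport F \ ⋃ y ∈ S, (e y).source) :=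
    hC.isClosed.isOpen_compl.mem_nhds hz₀
  have key : (fun z => ∑ y ∈ hS.toFinset, F ((e y).symm z)) =ᶠ[nhds z₀]
      fun z => ∑ᶠ y ∈ p ⁻¹' {z}, F y := by
    filter_upwards [hW1, hW2] with z h1 h2
    have hpz : ∀ y ∈ S, p ((e y).symm z) = z := fun y hy => by
      rw [← hpe y]; exact (e y).right_inv (h1 y hy)
    have hinj : Set.InjOn (fun y => (e y).symm z) (hS.toFinset : Set Y) := by
      intro y hy y' hy' h
      rw [Set.Finite.coe_toFinset] at hy hy'
      by_contra hne
      have h3 := ((e y).map_target (h1 y hy)).2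
      have h4 := ((e y').map_target (h1 y' hy')).2
      exact Set.disjoint_left.1 (hdisj hy hy' hne) h3 (by
        have h5 : (e y).symm z = (e y').symm z := h
        rw [h5]; exact h4)
    rw [← Finset.sum_image (g := fun y => (e y).symm z) (f := F) hinj, ← finsum_mem_coe_finset]
    refine finsum_mem_inter_support_eq' _ _ _ fun y hy => ?_
    constructor
    · intro h
      obtain ⟨y', hy', rfl⟩ := Finset.mem_image.1 (Finset.mem_coe.1 h)
      exact hpz y' (hS.mem_toFinset.1 hy')
    · intro h
      have h3 : p y = z := h
      have h4 : y ∈ ⋃ y ∈ S, (e y).source := by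
        by_contra h5
        exact h2 ⟨y, ⟨subset_tsupport F hy, h5⟩, h3⟩
      obtain ⟨y', hy', h5⟩ := Set.mem_iUnion₂.1 h4
      refine Finset.mem_coe.2 (Finset.mem_image.2 ⟨y', hS.mem_toFinset.2 hy', ?_⟩)
      rw [← h3, ← hpe y']
      exact (e y').left_inv h5
  refine ContinuousAt.congr ?_ key
  refine tendsto_finsetSum _ fun y hy => ?_
  exact hF.continuousAt.comp ((e y).continuousAt_symm (htarget y (hS.mem_toFinset.1 hy)))

theorem IsLocalHomeomorph.pullback_snd {A B : Type*} [TopologicalSpace A] [TopologicalSpace B]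
    {a : A → Z} {b : B → Z} (ha : IsLocalHomeomorph a) (hb : Continuous b) :
    IsLocalHomeomorph fun q : {q : A × B // a q.1 = b q.2} => q.1.2 := by
  have hopen : IsOpenMap fun q : {q : A × B // a q.1 = b q.2} => q.1.2 := by
    rw [isOpenMap_iff_nhds_le]
    rintro ⟨⟨x, y⟩, hxy⟩ N hN
    obtain ⟨N', hN', hN'N⟩ := mem_nhds_subtype _ _ _ |>.1 (Filter.mem_map.1 hN)
    obtain ⟨e, hxe, rfl⟩ := ha x
    have hxy' : e x = b y := hxy
    have h1 : b y ∈ e.target := hxy' ▸ e.map_source hxe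
    have h2 : Filter.Tendsto (fun y' => (e.symm (b y'), y')) (nhds y) (nhds (x, y)) := by
      have h3 : e.symm (b y) = x := by rw [← hxy', e.left_inv hxe]
      have h4 : ContinuousAt (fun y' => (e.symm (b y'), y')) y :=
        ((e.continuousAt_symm h1).comp hb.continuousAt).prodMk continuousAt_id
      rw [ContinuousAt, h3] at h4
      exact h4
    filter_upwards [h2 hN', hb.continuousAt.preimage_mem_nhds (e.open_target.mem_nhds h1)]
      with y' h3 h4
    exact hN'N (show (⟨(e.symm (b y'), y'), e.right_inv h4⟩ :
      {q : A × B // e q.1 = b q.2}).1 ∈ N' from h3)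
  rw [isLocalHomeomorph_iff_isOpenEmbedding_restrict]
  rintro ⟨⟨x, y⟩, hxy⟩
  obtain ⟨e, hxe, rfl⟩ := ha x
  have hc : Continuous fun q : {q : A × B // e q.1 = b q.2} => q.1.1 :=
    continuous_fst.comp continuous_subtype_val
  have hUo := e.open_source.preimage hc
  refine ⟨_, hUo.mem_nhds hxe, .of_continuous_injective_isOpenMap ?_ ?_ (hopen.domRestrict hUo)⟩
  · exact (continuous_snd.comp continuous_subtype_val).comp continuous_subtype_val
  · rintro ⟨⟨⟨x₁, y₁⟩, h₁⟩, h₁'⟩ ⟨⟨⟨x₂, y₂⟩, h₂⟩, h₂'⟩ h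
    have hy : y₁ = y₂ := h
    subst hy
    have hx : x₁ = x₂ := e.injOn h₁' h₂' (h₁.trans h₂.symm)
    subst hx
    rfl

end FiberSums

/-- The pairs `(fst, snd)` of equivalent elements, for an equivalence relation `E` on `X`; that is,
the set `R ⊆ X × X` that underlies the relation, with no topology. -/
@[ext]
structure RelPair {X : Type u} (E : Setoid X) where
  /-- the range of the pair -/
  fst : X
  /-- the source of the pair -/
  snd : X
  rel : E.r fst snd

namespace RelPair

variable {X : Type u} {E : Setoid X}

/-- The product `(x, y) (y, z) = (x, z)`. -/
def comp (γ η : RelPair E) (h : γ.snd = η.fst) : RelPair E :=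
  ⟨γ.fst, η.snd, E.iseqv.trans γ.rel (h ▸ η.rel)⟩

/-- The inverse `(x, y)⁻¹ = (y, x)`. -/
def inv (γ : RelPair E) : RelPair E := ⟨γ.snd, γ.fst, E.iseqv.symm γ.rel⟩

end RelPair

/-- An étale equivalence relation on `X`: an equivalence relation `R ⊆ X × X` with a `σ`-compact
topology (in general not the one of `X × X`) for which it is a topological groupoid, the diagonal
is open, and the range and source maps are local homeomorphisms to `X`. -/
structure EtaleEquivRel (X : Type u) [TopologicalSpace X] where
  /-- the equivalence relation -/
  rel : Setoid X
  /-- the topology of the relation -/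
  topology : TopologicalSpace (RelPair rel)
  sigmaCompact : SigmaCompactSpace (RelPair rel)
  isOpen_diagonal : IsOpen {γ : RelPair rel | γ.fst = γ.snd}
  isLocalHomeomorph_fst : IsLocalHomeomorph (RelPair.fst : RelPair rel → X)
  isLocalHomeomorph_snd : IsLocalHomeomorph (RelPair.snd : RelPair rel → X)
  continuous_comp : Continuous fun q : {q : RelPair rel × RelPair rel // q.1.snd = q.2.fst} =>
    q.1.1.comp q.1.2 q.2
  continuous_inv : Continuous (RelPair.inv : RelPair rel → RelPair rel)

namespace EtaleEquivRel

attribute [instance] EtaleEquivRel.topology EtaleEquivRel.sigmaCompact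

variable {X : Type u} [TopologicalSpace X] (R : EtaleEquivRel X)

/-- The `*`-algebra `C_c(R)` of continuous functions with compact support on `R`, with convolution
as its product. -/
def ConvAlgebra : Type u := C_c(RelPair R.rel, ℂ)

namespace ConvAlgebra

noncomputable instance : AddCommGroup R.ConvAlgebra :=
  inferInstanceAs (AddCommGroup C_c(RelPair R.rel, ℂ))

noncomputable instance : Module ℂ R.ConvAlgebra :=
  inferInstanceAs (Module ℂ C_c(RelPair R.rel, ℂ))

instance : FunLike R.ConvAlgebra (RelPair R.rel) ℂ :=
  inferInstanceAs (FunLike C_c(RelPair R.rel, ℂ) (RelPair R.rel) ℂ)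

variable {R}

theorem hasCompactSupport (f : R.ConvAlgebra) : HasCompactSupport f :=
  CompactlySupportedContinuousMap.hasCompactSupport f

theorem continuous (f : R.ConvAlgebra) : Continuous f :=
  (CompactlySupportedContinuousMap.toContinuousMap f).continuous

theorem add_apply (f g : R.ConvAlgebra) (γ : RelPair R.rel) : (f + g) γ = f γ + g γ := rfl

theorem zero_apply (γ : RelPair R.rel) : (0 : R.ConvAlgebra) γ = 0 := rfl

/-- The convolution `(f * g)(x, z) = ∑_{y ∈ [x]} f(x, y) g(y, z)` (a finite sum). -/
noncomputable def conv (f g : R.ConvAlgebra) (γ : RelPair R.rel) : ℂ :=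
  ∑ᶠ y : {y // R.rel.r γ.fst y},
    f ⟨γ.fst, y, y.2⟩ * g ⟨y, γ.snd, R.rel.iseqv.trans (R.rel.iseqv.symm y.2) γ.rel⟩

theorem conv_eq_fiberSum (f g : R.ConvAlgebra) (γ : RelPair R.rel) :
    conv f g γ = ∑ᶠ q ∈ (fun q : {q : RelPair R.rel × RelPair R.rel // q.1.snd = q.2.fst} =>
      q.1.1.comp q.1.2 q.2) ⁻¹' {γ}, f q.1.1 * g q.1.2 := by
  rw [← finsum_set_coe_eq_finsum_mem (f := fun q :
    {q : RelPair R.rel × RelPair R.rel // q.1.snd = q.2.fst} => f q.1.1 * g q.1.2)]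
  refine finsum_eq_of_bijective (fun y : {y // R.rel.r γ.fst y} =>
    ⟨⟨(⟨γ.fst, y, y.2⟩, ⟨y, γ.snd, R.rel.iseqv.trans (R.rel.iseqv.symm y.2) γ.rel⟩), rfl⟩, rfl⟩)
    ⟨?_, ?_⟩ fun y => rfl
  · intro y y' h
    exact Subtype.ext (congrArg (fun q => q.1.1.1.snd) h)
  · rintro ⟨⟨⟨⟨x, y, h⟩, ⟨y', z, h'⟩⟩, h''⟩, hq⟩
    have hq' : (⟨x, z, _⟩ : RelPair R.rel) = γ := hq
    subst hq'
    have h3 : y = y' := h''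
    subst h3
    exact ⟨⟨y, h⟩, rfl⟩

end ConvAlgebra

theorem isLocalHomeomorph_comp :
    IsLocalHomeomorph fun q : {q : RelPair R.rel × RelPair R.rel // q.1.snd = q.2.fst} =>
      q.1.1.comp q.1.2 q.2 := by
  refine IsLocalHomeomorph.of_comp (g := (RelPair.snd : RelPair R.rel → X)) ?_
    R.isLocalHomeomorph_snd R.continuous_comp
  have h := R.isLocalHomeomorph_snd.comp
    (R.isLocalHomeomorph_snd.pullback_snd R.isLocalHomeomorph_fst.continuous)
  exact h

variable [T2Space X]

instance : T2Space (RelPair R.rel) := by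
  refine T2Space.of_injective_continuous (f := fun γ : RelPair R.rel => (γ.fst, γ.snd)) ?_ ?_
  · intro γ η h
    exact RelPair.ext (congrArg Prod.fst h) (congrArg Prod.snd h)
  · exact R.isLocalHomeomorph_fst.continuous.prodMk R.isLocalHomeomorph_snd.continuous

namespace ConvAlgebra

variable {R}

theorem finite_support_conv (f g : R.ConvAlgebra) (γ : RelPair R.rel) :
    (Function.support fun y : {y // R.rel.r γ.fst y} => f ⟨γ.fst, y, y.2⟩ *
      g ⟨y, γ.snd, R.rel.iseqv.trans (R.rel.iseqv.symm y.2) γ.rel⟩).Finite := by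
  have h := R.isLocalHomeomorph_fst.finite_fiber_inter f.hasCompactSupport.isCompact γ.fst
  refine Set.Finite.of_finite_image (f := fun y : {y // R.rel.r γ.fst y} =>
    (⟨γ.fst, y, y.2⟩ : RelPair R.rel)) (h.subset ?_) ?_
  · rintro _ ⟨y, hy, rfl⟩
    exact ⟨rfl, subset_tsupport _ (left_ne_zero_of_mul hy)⟩
  · intro y _ y' _ h
    exact Subtype.ext (congrArg RelPair.snd h)

theorem hasCompactSupport_mul (f g : R.ConvAlgebra) : HasCompactSupport
    fun q : {q : RelPair R.rel × RelPair R.rel // q.1.snd = q.2.fst} => f q.1.1 * g q.1.2 := by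
  have h1 : HasCompactSupport fun q : RelPair R.rel × RelPair R.rel => f q.1 * g q.2 := by
    refine HasCompactSupport.intro
      (f.hasCompactSupport.isCompact.prod g.hasCompactSupport.isCompact) fun q hq => ?_
    by_contra h
    exact hq ⟨subset_tsupport _ (left_ne_zero_of_mul h), subset_tsupport _ (right_ne_zero_of_mul h)⟩
  refine h1.comp_isClosedEmbedding (g := Subtype.val) (IsClosed.isClosedEmbedding_subtypeVal ?_)
  exact isClosed_eq (R.isLocalHomeomorph_snd.continuous.comp continuous_fst)
    (R.isLocalHomeomorph_fst.continuous.comp continuous_snd)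

theorem continuous_conv (f g : R.ConvAlgebra) : Continuous (conv f g) := by
  rw [funext (conv_eq_fiberSum f g)]
  refine R.isLocalHomeomorph_comp.continuous_fiberSum ?_ (hasCompactSupport_mul f g)
  exact (f.continuous.comp (continuous_fst.comp continuous_subtype_val)).mul
    (g.continuous.comp (continuous_snd.comp continuous_subtype_val))

theorem hasCompactSupport_conv (f g : R.ConvAlgebra) : HasCompactSupport (conv f g) := by
  refine HasCompactSupport.intro
    ((hasCompactSupport_mul f g).isCompact.image R.continuous_comp) fun γ hγ => ?_
  rw [conv_eq_fiberSum]
  refine finsum_mem_eq_zero_of_forall_eq_zero fun q hq => ?_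
  by_contra h
  exact hγ ⟨q, subset_tsupport _ h, hq⟩

noncomputable instance : NonUnitalNonAssocRing R.ConvAlgebra :=
  { (inferInstance : AddCommGroup R.ConvAlgebra) with
    mul := fun f g => (⟨⟨conv f g, continuous_conv f g⟩, hasCompactSupport_conv f g⟩ :
      C_c(RelPair R.rel, ℂ))
    left_distrib := fun f g g' => DFunLike.ext _ _ fun γ => by
      change conv f (g + g') γ = conv f g γ + conv f g' γ
      rw [conv, conv, conv,
        ← finsum_add_distrib (finite_support_conv f g γ) (finite_support_conv f g' γ)]
      simp only [add_apply, mul_add]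
    right_distrib := fun f f' g => DFunLike.ext _ _ fun γ => by
      change conv (f + f') g γ = conv f g γ + conv f' g γ
      rw [conv, conv, conv,
        ← finsum_add_distrib (finite_support_conv f g γ) (finite_support_conv f' g γ)]
      simp only [add_apply, add_mul]
    zero_mul := fun g => DFunLike.ext _ _ fun γ => by
      change conv 0 g γ = 0
      simp [conv, zero_apply]
    mul_zero := fun f => DFunLike.ext _ _ fun γ => by
      change conv f 0 γ = 0
      simp [conv, zero_apply] }

theorem mul_apply (f g : R.ConvAlgebra) (γ : RelPair R.rel) : (f * g) γ =
    ∑ᶠ y : {y // R.rel.r γ.fst y},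
      f ⟨γ.fst, y, y.2⟩ * g ⟨y, γ.snd, R.rel.iseqv.trans (R.rel.iseqv.symm y.2) γ.rel⟩ := rfl

/-- The involution of `C_c(R)`, `f^*(x, y) = conj (f(y, x))`. -/
noncomputable instance : Star R.ConvAlgebra where
  star f := (⟨⟨fun γ => star (f γ.inv), (f.continuous.comp R.continuous_inv).star⟩, by
      refine HasCompactSupport.intro (f.hasCompactSupport.isCompact.image R.continuous_inv)
        fun γ hγ => ?_
      by_contra h
      exact hγ ⟨γ.inv, subset_tsupport _ fun h' => h (by simp [h']), rfl⟩⟩ :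
    C_c(RelPair R.rel, ℂ))

theorem star_apply (f : R.ConvAlgebra) (γ : RelPair R.rel) : star f γ = star (f γ.inv) := rfl

/-- The `I`-norm on `C_c(R)`, the maximum of `sup_x ∑_{y ∈ [x]} |f(x, y)|` and
`sup_y ∑_{x ∈ [y]} |f(x, y)|` (the sums are finite and the suprema are bounded). -/
noncomputable def iNorm (f : R.ConvAlgebra) : ℝ :=
  max (⨆ x, ∑ᶠ y : {y // R.rel.r x y}, ‖f ⟨x, y, y.2⟩‖)
    (⨆ y, ∑ᶠ x : {x // R.rel.r x y}, ‖f ⟨x, y, x.2⟩‖)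

theorem bddAbove_fiberSum {p : RelPair R.rel → X} (hp : IsLocalHomeomorph p) (f : R.ConvAlgebra) :
    BddAbove (Set.range fun x => ∑ᶠ γ ∈ p ⁻¹' {x}, ‖f γ‖) := by
  have hc := hp.continuous_fiberSum f.continuous.norm f.hasCompactSupport.norm
  refine hc.bddAbove_range_of_hasCompactSupport (HasCompactSupport.intro
    (f.hasCompactSupport.isCompact.image hp.continuous) fun x hx => ?_)
  refine finsum_mem_eq_zero_of_forall_eq_zero fun γ hγ => ?_
  by_contra h
  exact hx ⟨γ, subset_tsupport _ (norm_ne_zero_iff.1 h), hγ⟩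

theorem bddAbove_iNorm (f : R.ConvAlgebra) :
    BddAbove (Set.range fun x => ∑ᶠ y : {y // R.rel.r x y}, ‖f ⟨x, y, y.2⟩‖) ∧
      BddAbove (Set.range fun y => ∑ᶠ x : {x // R.rel.r x y}, ‖f ⟨x, y, x.2⟩‖) := by
  constructor
  · convert bddAbove_fiberSum R.isLocalHomeomorph_fst f using 3 with x
    rw [← finsum_set_coe_eq_finsum_mem (f := fun γ => ‖f γ‖)]
    refine finsum_eq_of_bijective (fun y => ⟨⟨x, y, y.2⟩, rfl⟩) ⟨?_, ?_⟩ fun y => rfl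
    · intro y y' h
      exact Subtype.ext (congrArg (fun q => q.1.snd) h)
    · rintro ⟨⟨x', y, h⟩, hx⟩
      have hx' : x' = x := hx
      subst hx'
      exact ⟨⟨y, h⟩, rfl⟩
  · convert bddAbove_fiberSum R.isLocalHomeomorph_snd f using 3 with y
    rw [← finsum_set_coe_eq_finsum_mem (f := fun γ => ‖f γ‖)]
    refine finsum_eq_of_bijective (fun x => ⟨⟨x, y, x.2⟩, rfl⟩) ⟨?_, ?_⟩ fun y => rfl
    · intro y y' h
      exact Subtype.ext (congrArg (fun q => q.1.fst) h)
    · rintro ⟨⟨x, y', h⟩, hx⟩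
      have hx' : y' = y := hx
      subst hx'
      exact ⟨⟨x, h⟩, rfl⟩

end ConvAlgebra

/-- The full groupoid C*-algebra `C^*(R)`, the completion of `C_c(R)` in the norm
`f ↦ sup_π ‖π f‖`, where `π` runs over the representations of `C_c(R)` that are bounded by the
`I`-norm (on Hilbert spaces in the universe `w`). -/
abbrev FullCStarAlgebra : Type (max u (w + 1)) :=
  EnvelopingCStarAlgebra.{u, w} R.ConvAlgebra ConvAlgebra.iNorm

end EtaleEquivRel

namespace PartialAction

variable {G : Type v} [Group G] {X : Type u} [TopologicalSpace X] (θ : PartialAction G X)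

/-- The orbit equivalence relation: `x ∼ y` if `h_t x = y` for some `t` with `x ∈ X_{t⁻¹}`. -/
def orbitSetoid : Setoid X where
  r x y := ∃ t, x ∈ θ.dom t⁻¹ ∧ θ.h t x = y
  iseqv := by
    refine ⟨fun x => ⟨1, by simp [θ.dom_one], θ.h_one x⟩, ?_, ?_⟩
    · rintro x _ ⟨t, hx, rfl⟩
      exact ⟨t⁻¹, by simpa using θ.map_mem hx, θ.inv_apply hx⟩
    · rintro x _ _ ⟨t, hx, rfl⟩ ⟨s, hy, rfl⟩
      have h1 : x ∈ θ.dom (t⁻¹ * s⁻¹) :=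
        θ.mem_inv_of_mem_mul hx (by rwa [mul_inv_cancel_left])
      exact ⟨s * t, by rwa [mul_inv_rev], (θ.h_comp s t x ⟨hx, h1⟩).symm⟩

/-- An element `t` of the group with `y = h_t x`, for a pair `(x, y)` of equivalent points. It is
unique if the action is free. -/
noncomputable def orbitElt (γ : RelPair θ.orbitSetoid) : G := Classical.choose γ.rel

theorem fst_mem (γ : RelPair θ.orbitSetoid) : γ.fst ∈ θ.dom (θ.orbitElt γ)⁻¹ :=
  (Classical.choose_spec γ.rel).1

theorem h_orbitElt (γ : RelPair θ.orbitSetoid) : θ.h (θ.orbitElt γ) γ.fst = γ.snd :=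
  (Classical.choose_spec γ.rel).2

/-- The topology of the orbit equivalence relation, induced from the product `X × G`, with `G`
discrete, by the map `(x, h_t x) ↦ (x, t)`. -/
noncomputable abbrev orbitTopology : TopologicalSpace (RelPair θ.orbitSetoid) :=
  letI : TopologicalSpace G := ⊥
  TopologicalSpace.induced (fun γ => (γ.fst, θ.orbitElt γ)) inferInstance

variable {θ}

theorem IsFree.eq_of_apply_eq (hθ : θ.IsFree) {t s : G} {x : X} (ht : x ∈ θ.dom t⁻¹)
    (hs : x ∈ θ.dom s⁻¹) (h : θ.h t x = θ.h s x) : t = s := by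
  have h1 : x ∈ θ.dom (s⁻¹ * t) := by
    refine θ.mem_inv_of_mem_mul hs ?_
    rw [mul_inv_cancel_left, ← h]
    exact θ.map_mem ht
  have h2 : θ.h (t⁻¹ * s) x = x := by
    rw [← θ.h_comp t⁻¹ s x ⟨hs, by simpa using h1⟩, ← h, θ.inv_apply ht]
  exact inv_mul_eq_one.1 (hθ (t⁻¹ * s) x (by simpa using h1) h2)

theorem IsFree.orbitElt_eq (hθ : θ.IsFree) (γ : RelPair θ.orbitSetoid) {t : G}
    (ht : γ.fst ∈ θ.dom t⁻¹) (h : θ.h t γ.fst = γ.snd) : θ.orbitElt γ = t :=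
  hθ.eq_of_apply_eq (θ.fst_mem γ) ht ((θ.h_orbitElt γ).trans h.symm)

theorem IsFree.orbitElt_inv (hθ : θ.IsFree) (γ : RelPair θ.orbitSetoid) :
    θ.orbitElt γ.inv = (θ.orbitElt γ)⁻¹ := by
  have h1 := θ.map_mem (θ.fst_mem γ)
  have h2 := θ.inv_apply (θ.fst_mem γ)
  rw [h_orbitElt] at h1 h2
  refine hθ.orbitElt_eq γ.inv ?_ h2
  rw [inv_inv]
  exact h1

theorem IsFree.orbitElt_comp (hθ : θ.IsFree) (γ η : RelPair θ.orbitSetoid) (h : γ.snd = η.fst) :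
    θ.orbitElt (γ.comp η h) = θ.orbitElt η * θ.orbitElt γ := by
  have hx := θ.fst_mem γ
  have hy : θ.h (θ.orbitElt γ) γ.fst ∈ θ.dom (θ.orbitElt η)⁻¹ := by
    rw [h_orbitElt, h]; exact θ.fst_mem η
  have h1 : γ.fst ∈ θ.dom ((θ.orbitElt γ)⁻¹ * (θ.orbitElt η)⁻¹) :=
    θ.mem_inv_of_mem_mul hx (by rwa [mul_inv_cancel_left])
  refine hθ.orbitElt_eq (γ.comp η h) ?_ ?_
  · rw [mul_inv_rev]; exact h1
  · change θ.h (θ.orbitElt η * θ.orbitElt γ) γ.fst = η.snd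
    rw [← θ.h_comp _ _ _ ⟨hx, h1⟩, h_orbitElt, h, h_orbitElt]

/-- The orbit equivalence relation of a free partial action of a countable group with `σ`-compact
domains is étale. -/
noncomputable def orbitRel [Countable G] (θ : PartialAction G X) (hθ : θ.IsFree)
    (hσ : ∀ t, IsSigmaCompact (θ.dom t)) : EtaleEquivRel X :=
  letI : TopologicalSpace G := ⊥
  haveI : DiscreteTopology G := ⟨rfl⟩
  letI := θ.orbitTopology
  have hind : Topology.IsInducing fun γ : RelPair θ.orbitSetoid => (γ.fst, θ.orbitElt γ) := ⟨rfl⟩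
  have hfst : Continuous fun γ : RelPair θ.orbitSetoid => γ.fst :=
    continuous_fst.comp hind.continuous
  have helt : Continuous θ.orbitElt := continuous_snd.comp hind.continuous
  have hnear : ∀ γ : RelPair θ.orbitSetoid, ∀ᶠ η in nhds γ, θ.orbitElt η = θ.orbitElt γ :=
    fun γ => helt.continuousAt.preimage_mem_nhds (isOpen_discrete {θ.orbitElt γ} |>.mem_nhds rfl)
  have hsnd : Continuous fun γ : RelPair θ.orbitSetoid => γ.snd := by
    rw [continuous_iff_continuousAt]
    intro γ
    have h1 : ContinuousAt (fun η : RelPair θ.orbitSetoid => θ.h (θ.orbitElt γ) η.fst) γ :=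
      ContinuousAt.comp (f := fun η : RelPair θ.orbitSetoid => η.fst)
        ((θ.h (θ.orbitElt γ)).continuousAt (by rw [θ.source_eq]; exact θ.fst_mem γ))
        hfst.continuousAt
    refine h1.congr ?_
    filter_upwards [hnear γ] with η hη
    rw [← hη, h_orbitElt]
  have hinv : Continuous (RelPair.inv : RelPair θ.orbitSetoid → RelPair θ.orbitSetoid) := by
    refine hind.continuous_iff.2 (hsnd.prodMk ?_)
    exact (continuous_of_discreteTopology.comp helt : Continuous fun γ => (θ.orbitElt γ)⁻¹).congr
      fun γ => (hθ.orbitElt_inv γ).symm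
  have hlocfst : IsLocalHomeomorph (RelPair.fst : RelPair θ.orbitSetoid → X) := by
    have hopen : IsOpenMap (RelPair.fst : RelPair θ.orbitSetoid → X) := by
      rw [isOpenMap_iff_nhds_le]
      intro γ N hN
      rw [Filter.mem_map, hind.nhds_eq_comap, Filter.mem_comap] at hN
      obtain ⟨N', hN', hN'N⟩ := hN
      have h1 : Filter.Tendsto (fun x => (x, θ.orbitElt γ)) (nhds γ.fst)
          (nhds (γ.fst, θ.orbitElt γ)) :=
        (continuous_id.prodMk continuous_const).continuousAt
      filter_upwards [h1 hN', (θ.isOpen_dom _).mem_nhds (θ.fst_mem γ)] with x h2 h3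
      let η : RelPair θ.orbitSetoid := ⟨x, θ.h (θ.orbitElt γ) x, ⟨_, h3, rfl⟩⟩
      have h4 : θ.orbitElt η = θ.orbitElt γ := hθ.orbitElt_eq η h3 rfl
      refine hN'N (show η ∈ _ from ?_)
      change (x, θ.orbitElt η) ∈ N'
      rw [h4]
      exact h2
    rw [isLocalHomeomorph_iff_isOpenEmbedding_restrict]
    intro γ
    have hU : IsOpen (θ.orbitElt ⁻¹' {θ.orbitElt γ}) := (isOpen_discrete _).preimage helt
    refine ⟨_, hU.mem_nhds rfl, .of_continuous_injective_isOpenMap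
      (hfst.comp continuous_subtype_val) ?_ (hopen.domRestrict hU)⟩
    rintro ⟨η, hη⟩ ⟨η', hη'⟩ h
    have h1 : η.fst = η'.fst := h
    have h2 : θ.orbitElt η = θ.orbitElt η' := hη.trans hη'.symm
    refine Subtype.ext (RelPair.ext h1 ?_)
    change η.snd = η'.snd
    rw [← h_orbitElt, ← h_orbitElt, h1, h2]
  { rel := θ.orbitSetoid
    topology := θ.orbitTopology
    sigmaCompact := by
      rw [← isSigmaCompact_univ_iff]
      have hsec : ∀ t, Continuous fun x : θ.dom t⁻¹ =>
          (⟨x, θ.h t x, ⟨t, x.2, rfl⟩⟩ : RelPair θ.orbitSetoid) := fun t => by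
        refine hind.continuous_iff.2 (continuous_subtype_val.prodMk ?_)
        refine (continuous_const (y := t)).congr fun x => ?_
        exact (hθ.orbitElt_eq ⟨x, θ.h t x, ⟨t, x.2, rfl⟩⟩ x.2 rfl).symm
      have hcov : (Set.univ : Set (RelPair θ.orbitSetoid)) = ⋃ t, Set.range fun x : θ.dom t⁻¹ =>
          (⟨x, θ.h t x, ⟨t, x.2, rfl⟩⟩ : RelPair θ.orbitSetoid) := by
        refine (Set.eq_univ_of_forall fun γ => Set.mem_iUnion.2 ⟨θ.orbitElt γ, ?_⟩).symm
        exact ⟨⟨γ.fst, θ.fst_mem γ⟩, RelPair.ext rfl (θ.h_orbitElt γ)⟩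
      rw [hcov]
      refine isSigmaCompact_iUnion _ fun t => ?_
      have : SigmaCompactSpace (θ.dom t⁻¹) := isSigmaCompact_iff_sigmaCompactSpace.1 (hσ t⁻¹)
      exact isSigmaCompact_range (hsec t)
    isOpen_diagonal := by
      have h1 : {γ : RelPair θ.orbitSetoid | γ.fst = γ.snd} = θ.orbitElt ⁻¹' {1} := by
        ext γ
        constructor
        · intro h
          exact hθ.orbitElt_eq γ (by simp [θ.dom_one]) ((θ.h_one _).trans h)
        · intro h
          have h2 : θ.orbitElt γ = 1 := h
          have h3 := θ.h_orbitElt γ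
          rw [h2, θ.h_one] at h3
          exact h3
      rw [h1]
      exact (isOpen_discrete _).preimage helt
    isLocalHomeomorph_fst := hlocfst
    isLocalHomeomorph_snd := by
      let e : RelPair θ.orbitSetoid ≃ₜ RelPair θ.orbitSetoid :=
        { toFun := RelPair.inv
          invFun := RelPair.inv
          left_inv := fun γ => rfl
          right_inv := fun γ => rfl
          continuous_toFun := hinv
          continuous_invFun := hinv }
      have h := hlocfst.comp e.isLocalHomeomorph
      exact h
    continuous_comp := by
      refine hind.continuous_iff.2 ((hfst.comp (continuous_fst.comp continuous_subtype_val)).prodMk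
        (Continuous.congr (f := fun q : {q : RelPair θ.orbitSetoid × RelPair θ.orbitSetoid //
          q.1.snd = q.2.fst} => θ.orbitElt q.1.2 * θ.orbitElt q.1.1) ?_
          fun q => (hθ.orbitElt_comp q.1.1 q.1.2 q.2).symm))
      have h1 : Continuous fun q : G × G => q.1 * q.2 := continuous_of_discreteTopology
      exact h1.comp ((helt.comp (continuous_snd.comp continuous_subtype_val)).prodMk
        (helt.comp (continuous_fst.comp continuous_subtype_val)))
    continuous_inv := hinv }

end PartialAction

/-! Freeness makes the group element linking two equivalent points unique, so `R` is the disjoint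
union of the clopen sheets `{(x, h_{t⁻¹} x) : x ∈ X_t}`. A function `f ∈ C_c(R)` meets finitely many
sheets and is the same as the finite family `f_t x = f (x, h_{t⁻¹} x)` of functions with compact
support in `X_t`. The map `f ↦ ∑ f_t δ_t` (`sheetHom`) is an injective `*`-homomorphism into `𝓛`:
convolution over an orbit turns into the product of `𝓛`. Its range, the finite sums with compactly
supported coefficients, is `ℓ¹`-dense.

The two norms are different (in general the `ℓ¹`-norm is larger than the `I`-norm), so the envelopes
are compared through representations. By `EnvelopingCStarAlgebra.map_bijective` it suffices, besides
density, to restrict and to extend bounded representations.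

Restriction (`norm_rep_sheetHom_le`) is the harder half: a representation `ρ` of `𝓛` bounded by the
`ℓ¹`-norm must be bounded by the `I`-norm on `C_c(R)`. This is a Schur test. Write `f_t = b_t c_t`
with `|b_t|² = |c_t|² = |f_t|`, and put `U_t = ρ (b_t δ_1)`, `V_t = ρ (c_t δ_t)`. Then `∑ U_t U_t^*`
and `∑ V_t^* V_t` are the images of the functions `∑ |f_t|` and `∑ |f_t| ∘ h_t` in `C₀(X)`, whose
sup norms are bounded by the two halves of the `I`-norm. The Cauchy–Schwarz inequality for
operators, `norm_sum_mul_le_of_norm_sum_le`, bounds `∑ U_t V_t`.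

Extension (`extendRep`): on a single sheet the `I`-norm is at most the sup norm
(`iNorm_ofSheet_le`), so a representation of `C_c(R)` extends by continuity to each `C₀(X_t) δ_t` on
the same Hilbert space. The algebraic identities pass to the limit, and the triangle inequality
gives the `ℓ¹`-bound. -/

/-! ### Functoriality of the enveloping C*-algebra -/

section EnvelopeMap

variable {B₁ : Type u} [NonUnitalNonAssocRing B₁] [Module ℂ B₁] [Star B₁] {N₁ : B₁ → ℝ}
  {B₂ : Type v} [NonUnitalNonAssocRing B₂] [Module ℂ B₂] [Star B₂] {N₂ : B₂ → ℝ}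
  (j : B₁ →⋆ₙₐ[ℂ] B₂) (hj : ∀ (ρ : BoundedRep.{v, w} B₂ N₂) (b : B₁), ‖ρ.π (j b)‖ ≤ N₁ b)

/-- The restriction of a representation along a `*`-homomorphism. -/
noncomputable def BoundedRep.restrict (ρ : BoundedRep.{v, w} B₂ N₂) : BoundedRep.{u, w} B₁ N₁ where
  H := ρ.H
  π := ρ.π.comp j
  bound := hj ρ

/-- Restriction of representations induces a map of the products of all representations. -/
noncomputable def RepProduct.map : RepProduct.{u, w} B₁ N₁ →⋆ₙₐ[ℂ] RepProduct.{v, w} B₂ N₂ where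
  toFun T := ⟨fun ρ => T.1 (ρ.restrict j hj), memℓp_infty ⟨‖T‖, by
    rintro _ ⟨ρ, rfl⟩
    exact lp.norm_apply_le_norm ENNReal.top_ne_zero T (ρ.restrict j hj)⟩⟩
  map_smul' _ _ := rfl
  map_zero' := rfl
  map_add' _ _ := rfl
  map_mul' _ _ := rfl
  map_star' _ := rfl

theorem RepProduct.norm_map_le (T : RepProduct.{u, w} B₁ N₁) :
    ‖RepProduct.map.{u, v, w} j hj T‖ ≤ ‖T‖ :=
  lp.norm_le_of_forall_le (norm_nonneg T) fun ρ =>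
    lp.norm_apply_le_norm ENNReal.top_ne_zero T (ρ.restrict j hj)

theorem RepProduct.continuous_map : Continuous (RepProduct.map.{u, v, w} j hj) :=
  AddMonoidHomClass.continuous_of_bound _ 1 fun T => by
    rw [one_mul]; exact RepProduct.norm_map_le j hj T

/-- The map of the enveloping C*-algebras induced by a `*`-homomorphism. -/
noncomputable def EnvelopingCStarAlgebra.map :
    EnvelopingCStarAlgebra.{u, w} B₁ N₁ →⋆ₙₐ[ℂ] EnvelopingCStarAlgebra.{v, w} B₂ N₂ where
  toFun T := ⟨RepProduct.map j hj T.1, by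
    have h := map_mem_closure (RepProduct.continuous_map j hj) T.2
      (t := Set.range (universalRep.{v, w} B₂ N₂)) (by
        rintro _ ⟨b, rfl⟩
        exact ⟨j b, rfl⟩)
    exact h⟩
  map_smul' _ _ := rfl
  map_zero' := rfl
  map_add' _ _ := rfl
  map_mul' _ _ := rfl
  map_star' _ := rfl

theorem EnvelopingCStarAlgebra.map_toEnvelope (b : B₁) :
    EnvelopingCStarAlgebra.map.{u, v, w} j hj (toEnvelope B₁ N₁ b) = toEnvelope B₂ N₂ (j b) := rfl

theorem EnvelopingCStarAlgebra.continuous_map :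
    Continuous (EnvelopingCStarAlgebra.map.{u, v, w} j hj) :=
  ((RepProduct.continuous_map j hj).comp continuous_subtype_val).subtype_mk _

theorem norm_apply_le_norm_toEnvelope (ρ : BoundedRep.{v, w} B₂ N₂) (b : B₂) :
    ‖ρ.π b‖ ≤ ‖toEnvelope.{v, w} B₂ N₂ b‖ :=
  lp.norm_apply_le_norm ENNReal.top_ne_zero (universalRep.{v, w} B₂ N₂ b) ρ

theorem toEnvelope_sub (a b : B₂) :
    toEnvelope.{v, w} B₂ N₂ (a - b) = toEnvelope B₂ N₂ a - toEnvelope B₂ N₂ b :=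
  Subtype.ext (map_sub (universalRep B₂ N₂) a b)

/-- A `*`-homomorphism with dense range, along which all the bounded representations extend, induces
an isomorphism of enveloping C*-algebras. -/
theorem EnvelopingCStarAlgebra.map_bijective
    (hext : ∀ π : BoundedRep.{u, w} B₁ N₁, ∃ ρ : BoundedRep.{v, w} B₂ N₂,
      ∀ b, ‖π.π b‖ ≤ ‖ρ.π (j b)‖)
    (hdense : ∀ b : B₂, ∀ ε > 0, ∃ a : B₁, N₂ (b - j a) < ε) :
    Function.Bijective (EnvelopingCStarAlgebra.map.{u, v, w} j hj) := by
  -- Restriction of representations makes the map contractive; extension gives the reverse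
  -- inequality on the dense image of `B₁`. An isometry of a complete space has closed range, so
  -- dense range will give surjectivity.
  have hnorm : ∀ T, ‖EnvelopingCStarAlgebra.map.{u, v, w} j hj T‖ = ‖T‖ := by
    intro T
    refine (denseRange_toEnvelope.{u, w} B₁ N₁).induction_on T ?_ fun b => ?_
    · exact isClosed_eq (EnvelopingCStarAlgebra.continuous_map j hj).norm continuous_norm
    · refine le_antisymm (RepProduct.norm_map_le j hj _) ?_
      rw [EnvelopingCStarAlgebra.map_toEnvelope, norm_toEnvelope]
      refine Real.iSup_le (fun π => ?_) (norm_nonneg _)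
      obtain ⟨ρ, hρ⟩ := hext π
      exact (hρ b).trans (norm_apply_le_norm_toEnvelope ρ _)
  have hiso : Isometry (EnvelopingCStarAlgebra.map.{u, v, w} j hj) :=
    AddMonoidHomClass.isometry_of_norm _ hnorm
  refine ⟨hiso.injective, fun T => ?_⟩
  have hcl : IsClosed (Set.range (EnvelopingCStarAlgebra.map.{u, v, w} j hj)) :=
    hiso.isClosedEmbedding.isClosed_range
  refine (denseRange_toEnvelope.{v, w} B₂ N₂).induction_on
    (p := (· ∈ Set.range (EnvelopingCStarAlgebra.map.{u, v, w} j hj))) T hcl fun b => ?_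
  rw [← hcl.closure_eq, Metric.mem_closure_range_iff]
  intro ε hε
  obtain ⟨a, ha⟩ := hdense b ε hε
  refine ⟨toEnvelope B₁ N₁ a, ?_⟩
  rw [EnvelopingCStarAlgebra.map_toEnvelope, dist_eq_norm, ← toEnvelope_sub, norm_toEnvelope]
  -- A real supremum over an empty family is `0`, while `ciSup_le` needs a nonempty one.
  obtain h | h := isEmpty_or_nonempty (BoundedRep.{v, w} B₂ N₂)
  · rw [Real.iSup_of_isEmpty]; exact hε
  · exact (ciSup_le fun ρ => ρ.bound _).trans_lt ha

end EnvelopeMap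

/-! ### Cauchy–Schwarz for operators, and the square-root factorization in `C₀(X)` -/

/-- The sum is the row `(U_i)` times the column `(V_i)`, and by the C*-identity each of the two has
norm at most `√C`. The proof runs this by hand on vectors. -/
theorem norm_sum_mul_le_of_norm_sum_le {ι H : Type*} [NormedAddCommGroup H] [InnerProductSpace ℂ H]
    [CompleteSpace H] (S : Finset ι) (U V : ι → H →L[ℂ] H) {C : ℝ}
    (hU : ‖∑ i ∈ S, U i * star (U i)‖ ≤ C) (hV : ‖∑ i ∈ S, star (V i) * V i‖ ≤ C) :
    ‖∑ i ∈ S, U i * V i‖ ≤ C := by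
  have hC : 0 ≤ C := (norm_nonneg _).trans hU
  have key : ∀ (W : ι → H →L[ℂ] H) (ξ : H), ‖∑ i ∈ S, star (W i) * W i‖ ≤ C →
      ∑ i ∈ S, ‖W i ξ‖ ^ 2 ≤ C * ‖ξ‖ ^ 2 := fun W ξ hW => by
    -- The squared norm of the column applied to `ξ` is the quadratic form of `∑ W_i^* W_i`.
    have h1 : ((∑ i ∈ S, ‖W i ξ‖ ^ 2 : ℝ) : ℂ) = inner ℂ ((∑ i ∈ S, star (W i) * W i) ξ) ξ := by
      rw [sum_apply, sum_inner]
      push_cast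
      refine Finset.sum_congr rfl fun i _ => ?_
      rw [Function.comp_apply, ContinuousLinearMap.star_eq_adjoint,
        ContinuousLinearMap.adjoint_inner_left, inner_self_eq_norm_sq_to_K]
      rfl
    have h2 : ∑ i ∈ S, ‖W i ξ‖ ^ 2 ≤ ‖((∑ i ∈ S, ‖W i ξ‖ ^ 2 : ℝ) : ℂ)‖ := by
      rw [Complex.norm_real]; exact le_abs_self _
    rw [h1] at h2
    calc _ ≤ _ := h2
      _ ≤ _ := norm_inner_le_norm _ _
      _ ≤ ‖∑ i ∈ S, star (W i) * W i‖ * ‖ξ‖ * ‖ξ‖ := by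
        gcongr; exact ContinuousLinearMap.le_opNorm _ _
      _ ≤ C * ‖ξ‖ * ‖ξ‖ := by gcongr
      _ = _ := by ring
  refine ContinuousLinearMap.opNorm_le_bound _ hC fun ξ => ?_
  set η := (∑ i ∈ S, U i * V i) ξ with hη
  have h1 : ‖η‖ ^ 2 ≤ ∑ i ∈ S, ‖V i ξ‖ * ‖star (U i) η‖ := by
    have h2 : inner ℂ η η = ∑ i ∈ S, inner ℂ (V i ξ) (star (U i) η) := by
      change inner ℂ ((∑ i ∈ S, U i * V i) ξ) η = _
      rw [sum_apply, sum_inner]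
      refine Finset.sum_congr rfl fun i _ => ?_
      rw [mul_apply_eq_comp, ContinuousLinearMap.star_eq_adjoint,
        ContinuousLinearMap.adjoint_inner_right]
    calc ‖η‖ ^ 2 = ‖inner ℂ η η‖ := by rw [inner_self_eq_norm_sq_to_K]; simp
      _ ≤ _ := by
        rw [h2]
        exact norm_sum_le_of_le _ fun i _ => norm_inner_le_norm _ _
  have h2 := Finset.sum_mul_sq_le_sq_mul_sq S (fun i => ‖V i ξ‖) fun i => ‖star (U i) η‖
  have h3 := key V ξ hV
  -- The row estimate is the column estimate for the adjoints.
  have h4 := key (fun i => star (U i)) η (by simpa using hU)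
  have h5 : (‖η‖ ^ 2) ^ 2 ≤ (C * ‖ξ‖ * ‖η‖) ^ 2 :=
    calc (‖η‖ ^ 2) ^ 2 ≤ (∑ i ∈ S, ‖V i ξ‖ * ‖star (U i) η‖) ^ 2 := by gcongr
      _ ≤ _ := h2
      _ ≤ (C * ‖ξ‖ ^ 2) * (C * ‖η‖ ^ 2) := by gcongr
      _ = _ := by ring
  have h6 := le_of_sq_le_sq h5 (by positivity)
  -- So far `‖η‖² ≤ C ‖ξ‖ ‖η‖`; one factor `‖η‖` has to be cancelled.
  by_cases h0 : ‖η‖ = 0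
  · rw [h0]; positivity
  · have : 0 < ‖η‖ := lt_of_le_of_ne (norm_nonneg _) (Ne.symm h0)
    nlinarith

section CompLeft

variable {X : Type u} [TopologicalSpace X]

/-- The composition of a function in `C₀(X)` with a continuous function on `ℂ` that vanishes
at `0`. -/
noncomputable def c0CompLeft (φ : C(ℂ, ℂ)) (hφ : φ 0 = 0) (f : C₀(X, ℂ)) : C₀(X, ℂ) where
  toFun x := φ (f x)
  continuous_toFun := φ.continuous.comp (map_continuous f)
  zero_at_infty' := by
    have h := (φ.continuous.tendsto 0).comp (zero_at_infty f)
    rwa [hφ] at h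

theorem c0CompLeft_apply (φ : C(ℂ, ℂ)) (hφ : φ 0 = 0) (f : C₀(X, ℂ)) (x : X) :
    c0CompLeft φ hφ f x = φ (f x) := rfl

theorem c0CompLeft_mem (φ : C(ℂ, ℂ)) (hφ : φ 0 = 0) {U : Set X} {f : C₀(X, ℂ)}
    (hf : f ∈ c0Ideal U) : c0CompLeft φ hφ f ∈ c0Ideal U := fun x hx => by
  rw [c0CompLeft_apply, hf x hx, hφ]

theorem ZeroAtInftyContinuousMap.norm_le_of_forall {f : C₀(X, ℂ)} {C : ℝ} (hC : 0 ≤ C)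
    (h : ∀ x, ‖f x‖ ≤ C) : ‖f‖ ≤ C := by
  rw [← ZeroAtInftyContinuousMap.norm_toBCF_eq_norm]
  exact (BoundedContinuousFunction.norm_le hC).2 h

theorem ZeroAtInftyContinuousMap.norm_apply_le (f : C₀(X, ℂ)) (x : X) : ‖f x‖ ≤ ‖f‖ := by
  rw [← ZeroAtInftyContinuousMap.norm_toBCF_eq_norm]
  exact f.toBCF.norm_coe_le_norm x

/-- Evaluation at a point, as an additive map on `C₀(X)`. -/
noncomputable def c0Eval (x : X) : C₀(X, ℂ) →+ ℂ where
  toFun f := f x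
  map_zero' := rfl
  map_add' _ _ := rfl

end CompLeft

/-- The function `z ↦ √|z|`. -/
noncomputable def sqrtNorm : C(ℂ, ℂ) where
  toFun z := (√‖z‖ : ℝ)
  continuous_toFun := Complex.continuous_ofReal.comp (Real.continuous_sqrt.comp continuous_norm)

theorem sqrtNorm_zero : sqrtNorm 0 = 0 := by simp [sqrtNorm]

/-- The function `z ↦ z / √|z|`. -/
noncomputable def divSqrtNorm : C(ℂ, ℂ) where
  toFun z := z / (√‖z‖ : ℝ)
  continuous_toFun := by
    rw [continuous_iff_continuousAt]
    intro z
    by_cases hz : z = 0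
    · subst hz
      -- At `0` the quotient is `0 / 0 = 0`, and its modulus `√|z|` tends to that value.
      have h : ∀ z : ℂ, ‖z / (√‖z‖ : ℝ)‖ = √‖z‖ := fun z => by
        rw [norm_div, Complex.norm_real, Real.norm_of_nonneg (Real.sqrt_nonneg _), Real.div_sqrt]
      rw [ContinuousAt, zero_div, tendsto_zero_iff_norm_tendsto_zero]
      simp only [h]
      have h2 : Continuous fun z : ℂ => √‖z‖ := Real.continuous_sqrt.comp continuous_norm
      simpa using h2.tendsto 0
    · refine ContinuousAt.div continuousAt_id sqrtNorm.continuous.continuousAt ?_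
      simpa [sqrtNorm] using hz

theorem divSqrtNorm_zero : divSqrtNorm 0 = 0 := by simp [divSqrtNorm]

theorem sqrtNorm_mul_divSqrtNorm (z : ℂ) : sqrtNorm z * divSqrtNorm z = z := by
  by_cases hz : z = 0
  · simp [hz, sqrtNorm_zero]
  · have : ((√‖z‖ : ℝ) : ℂ) ≠ 0 := by simpa using hz
    exact mul_div_cancel₀ _ this

theorem norm_sqrtNorm_sq (z : ℂ) : ‖sqrtNorm z‖ ^ 2 = ‖z‖ := by
  change ‖((√‖z‖ : ℝ) : ℂ)‖ ^ 2 = _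
  rw [Complex.norm_real, Real.norm_of_nonneg (Real.sqrt_nonneg _), Real.sq_sqrt (norm_nonneg _)]

theorem norm_divSqrtNorm_sq (z : ℂ) : ‖divSqrtNorm z‖ ^ 2 = ‖z‖ := by
  change ‖z / ((√‖z‖ : ℝ) : ℂ)‖ ^ 2 = _
  rw [norm_div, Complex.norm_real, Real.norm_of_nonneg (Real.sqrt_nonneg _), Real.div_sqrt,
    Real.sq_sqrt (norm_nonneg _)]

/-! ### Coefficients and the `ℓ¹`-norm on `𝓛` -/

namespace CStarPartialAction.FinSums

variable {G : Type v} [Group G] {A : Type u} [NonUnitalCStarAlgebra A] {Θ : CStarPartialAction G A}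

theorem coeff_add (a b : Θ.FinSums) (t : G) : (a + b).coeff t = a.coeff t + b.coeff t :=
  DFinsupp.add_apply (a : Π₀ t, Θ.D t) b t

theorem coeff_smul (c : ℂ) (a : Θ.FinSums) (t : G) : (c • a).coeff t = c • a.coeff t :=
  DFinsupp.smul_apply c (a : Π₀ t, Θ.D t) t

open Classical in
theorem coe_coeff_single (t s : G) (x : Θ.D t) :
    ((single Θ t x).coeff s : A) = if s = t then (x : A) else 0 := by
  split_ifs with h
  · subst h; rw [coeff_single_self]
  · rw [coeff_single_of_ne h]; rfl

theorem single_congr {t s : G} {x : Θ.D t} {y : Θ.D s} (h : t = s) (hxy : (x : A) = y) :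
    single Θ t x = single Θ s y := by
  subst h
  rw [Subtype.ext hxy]

theorem l1Norm_single (t : G) (x : Θ.D t) : l1Norm (single Θ t x) = ‖(x : A)‖ := by
  rw [l1Norm, finsum_eq_single _ t fun s hs => by rw [coeff_single_of_ne hs]; exact norm_zero,
    coeff_single_self]

theorem coeff_sum_single {S : Finset G} (x : ∀ t, Θ.D t) (hS : ∀ t, t ∉ S → x t = 0) (s : G) :
    (∑ t ∈ S, single Θ t (x t)).coeff s = x s := by
  classical
  refine Subtype.ext ?_
  let e : Θ.FinSums →+ A :=
    { toFun := fun a => a.coeff s, map_zero' := rfl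
      map_add' := fun a b => congrArg Subtype.val (coeff_add a b s) }
  change e _ = _
  rw [map_sum]
  change ∑ t ∈ S, ((single Θ t (x t)).coeff s : A) = _
  simp only [coe_coeff_single]
  rw [Finset.sum_ite_eq S s fun t => (x t : A)]
  split_ifs with h
  · rfl
  · rw [hS s h]; rfl

theorem sum_single_coeff (a : Θ.FinSums) {S : Finset G} (hS : ∀ t, t ∉ S → a.coeff t = 0) :
    ∑ t ∈ S, single Θ t (a.coeff t) = a :=
  ext (coeff_sum_single a.coeff hS)

theorem finite_support_norm_coeff (a : Θ.FinSums) :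
    (Function.support fun t => ‖(a.coeff t : A)‖).Finite :=
  a.finite_support_coeff.subset fun t ht h =>
    ht ((congrArg (fun x : Θ.D t => ‖(x : A)‖) h).trans norm_zero)

theorem l1Norm_add_le (a b : Θ.FinSums) : l1Norm (a + b) ≤ l1Norm a + l1Norm b := by
  have ha := a.finite_support_norm_coeff
  have hb := b.finite_support_norm_coeff
  rw [l1Norm, l1Norm, l1Norm, ← finsum_add_distrib ha hb]
  refine finsum_le_finsum' (finite_support_norm_coeff _) ((ha.union hb).subset
    (Function.support_add _ _)) fun t => ?_
  rw [coeff_add]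
  exact norm_add_le _ _

/-- The `ℓ¹`-norm is the largest seminorm that is bounded by the norm of `A` on each summand; this
gives the bound for the extended representations. -/
theorem norm_apply_le_l1Norm {E : Type*} [NormedAddCommGroup E] [NormedSpace ℂ E]
    (σ : Θ.FinSums →ₗ[ℂ] E) (hσ : ∀ t x, ‖σ (single Θ t x)‖ ≤ ‖(x : A)‖) (a : Θ.FinSums) :
    ‖σ a‖ ≤ l1Norm a := by
  have hS := a.finite_support_coeff
  have h0 : ∀ t, t ∉ hS.toFinset → a.coeff t = 0 := fun t ht => by
    rw [Set.Finite.mem_toFinset] at ht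
    exact not_not.1 ht
  rw [l1Norm, finsum_eq_sum_of_support_subset (s := hS.toFinset)]
  · conv_lhs => rw [← sum_single_coeff a h0, map_sum]
    exact norm_sum_le_of_le _ fun t _ => hσ t _
  · intro t ht
    rw [Set.Finite.coe_toFinset]
    intro h
    exact ht ((congrArg (fun x : Θ.D t => ‖(x : A)‖) h).trans norm_zero)

end CStarPartialAction.FinSums

/-! ### Pointwise formulas in `𝓛` and the Schur test -/

namespace PartialAction

open CStarPartialAction

variable {G : Type v} [Group G] {X : Type u} [TopologicalSpace X] {θ : PartialAction G X}

theorem inv_mem {t : G} {z : X} (hz : z ∈ θ.dom t) : z ∈ θ.dom t⁻¹⁻¹ := by rwa [inv_inv]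

theorem apply_inv {t : G} {z : X} (hz : z ∈ θ.dom t) : θ.h t (θ.h t⁻¹ z) = z := by
  have h := θ.inv_apply (inv_mem hz)
  rwa [inv_inv] at h

variable [T2Space X]

theorem α_apply {t : G} (x : θ.c0Action.D t⁻¹) {z : X} (hz : z ∈ θ.dom t) :
    (θ.c0Action.α t x).1 z = x.1 (θ.h t⁻¹ z) :=
  (c0Push_apply (θ.h t) (θ.source_eq t) (θ.target_eq t) x hz).trans (by rw [θ.symm_apply hz])

theorem α_symm_apply {t : G} (x : θ.c0Action.D t) {z : X} (hz : z ∈ θ.dom t⁻¹) :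
    ((θ.c0Action.α t).symm x).1 z = x.1 (θ.h t z) :=
  c0Push_apply (θ.h t).symm (θ.target_eq t) (θ.source_eq t) x hz

/-- On `X_t` the maps `α_t` and `α_{t⁻¹}` cancel on `x`. Off `X_t` the value `h_{t⁻¹} z` is
meaningless, but the factor `x z = 0` removes it, so the formula holds for every `z`. -/
theorem mulCoeff_apply (t s : G) (x : θ.c0Action.D t) (y : θ.c0Action.D s) (z : X) :
    (θ.c0Action.mulCoeff t s x y).1 z = x.1 z * y.1 (θ.h t⁻¹ z) := by
  by_cases hz : z ∈ θ.dom t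
  · refine (α_apply _ hz).trans ?_
    change ((θ.c0Action.α t).symm x).1 (θ.h t⁻¹ z) * y.1 (θ.h t⁻¹ z) = _
    rw [α_symm_apply _ (θ.map_mem (inv_mem hz)), apply_inv hz]
  · have h1 : x.1 z = 0 := x.2 z hz
    rw [h1, zero_mul]
    exact (θ.c0Action.α t _).2 z hz

theorem finSums_ext {a b : θ.c0Action.FinSums}
    (h : ∀ t, ∀ z ∈ θ.dom t, (a.coeff t).1 z = (b.coeff t).1 z) : a = b :=
  FinSums.ext fun t => c0Ideal_ext (h t)

theorem coeff_star_apply (a : θ.c0Action.FinSums) {t : G} {z : X} (hz : z ∈ θ.dom t) :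
    ((star a).coeff t).1 z = star ((a.coeff t⁻¹).1 (θ.h t⁻¹ z)) :=
  α_apply _ hz

theorem coeff_mul_apply (a b : θ.c0Action.FinSums) (s : G) (z : X) :
    ((a * b).coeff s).1 z = ∑ᶠ t, (a.coeff t).1 z * (b.coeff (t⁻¹ * s)).1 (θ.h t⁻¹ z) := by
  rw [FinSums.coeff_mul]
  change c0Eval z _ = _
  rw [AddMonoidHom.map_finsum]
  · exact finsum_congr fun t => mulCoeff_apply _ _ _ _ z
  · refine a.finite_support_coeff.subset fun t ht h => ht ?_
    change a.coeff t = 0 at h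
    ext z
    rw [mulCoeff_apply, h]
    exact zero_mul _

theorem star_single (t : G) (x : θ.c0Action.D t) :
    star (FinSums.single θ.c0Action t x) =
      FinSums.single θ.c0Action t⁻¹ ((θ.c0Action.α t).symm (star x)) := by
  classical
  refine finSums_ext fun s z hz => ?_
  rw [coeff_star_apply _ hz, FinSums.coe_coeff_single, FinSums.coe_coeff_single]
  by_cases h : s = t⁻¹
  · subst h
    rw [if_pos (inv_inv t), if_pos rfl, α_symm_apply _ hz, inv_inv]
    rfl
  · rw [if_neg h, if_neg fun h' => h (by rw [← h', inv_inv])]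
    exact star_zero _

theorem mem_D_one (f : C₀(X, ℂ)) : f ∈ θ.c0Action.D 1 := by
  rw [θ.c0Action.D_one]; trivial

/-- The element `f δ_1` of `𝓛`. -/
noncomputable def unitSingle (θ : PartialAction G X) : C₀(X, ℂ) →+ θ.c0Action.FinSums where
  toFun f := FinSums.single θ.c0Action 1 ⟨f, mem_D_one f⟩
  map_zero' := map_zero (FinSums.single θ.c0Action 1)
  map_add' f g := map_add (FinSums.single θ.c0Action 1) ⟨f, mem_D_one f⟩ ⟨g, mem_D_one g⟩

theorem unitSingle_mul_single (f : C₀(X, ℂ)) (t : G) (x y : θ.c0Action.D t)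
    (h : ∀ z, f z * x.1 z = y.1 z) :
    θ.unitSingle f * FinSums.single θ.c0Action t x = FinSums.single θ.c0Action t y := by
  refine (FinSums.single_mul_single _ _ _ _).trans (FinSums.single_congr (one_mul t) ?_)
  ext z
  rw [mulCoeff_apply, inv_one, θ.h_one, ← h]

theorem unitSingle_mul_star (f : C₀(X, ℂ)) :
    θ.unitSingle f * star (θ.unitSingle f) = θ.unitSingle (f * star f) := by
  change θ.unitSingle f * star (FinSums.single θ.c0Action 1 ⟨f, mem_D_one f⟩) = _
  rw [star_single]
  refine (FinSums.single_mul_single _ _ _ _).trans (FinSums.single_congr (by simp) ?_)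
  ext z
  have h1 : θ.h 1⁻¹ z = z := by rw [inv_one, θ.h_one]
  rw [mulCoeff_apply, h1, α_symm_apply _ (by simp [θ.dom_one]), θ.h_one]
  rfl

/-- The degrees `t⁻¹` and `t` cancel, which leaves the function `|x|² ∘ h_t` in degree `1`. In the
Schur test this turns `∑ V_t^* V_t` into the image of a single function. -/
theorem star_single_mul_single (t : G) (x : θ.c0Action.D t) :
    star (FinSums.single θ.c0Action t x) * FinSums.single θ.c0Action t x =
      θ.unitSingle ((θ.c0Action.α t).symm (star x * x)).1 := by
  rw [star_single]
  refine (FinSums.single_mul_single _ _ _ _).trans (FinSums.single_congr (inv_mul_cancel t) ?_)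
  ext z
  rw [mulCoeff_apply, inv_inv, map_mul]
  change _ = ((θ.c0Action.α t).symm (star x)).1 z * ((θ.c0Action.α t).symm x).1 z
  by_cases hz : z ∈ θ.dom t⁻¹
  · rw [α_symm_apply x hz]
  · have : ((θ.c0Action.α t).symm (star x)).1 z = 0 := ((θ.c0Action.α t).symm (star x)).2 z hz
    rw [this, zero_mul, zero_mul]

/-- In degree `1` the `ℓ¹`-norm is the sup norm. A sum over `t` collected there is thus estimated
pointwise, by the supremum of a sum in place of a sum of suprema. -/
theorem norm_rep_unitSingle_le (ρ : BoundedRep.{max u v, w} θ.c0Action.FinSums FinSums.l1Norm)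
    (f : C₀(X, ℂ)) : ‖ρ.π (θ.unitSingle f)‖ ≤ ‖f‖ :=
  (ρ.bound _).trans (FinSums.l1Norm_single 1 (⟨f, mem_D_one f⟩ : θ.c0Action.D 1)).le

/-- A representation of `𝓛` bounded by the `ℓ¹`-norm satisfies the estimate of the Schur test. -/
theorem norm_rep_sum_single_le (ρ : BoundedRep.{max u v, w} θ.c0Action.FinSums FinSums.l1Norm)
    (S : Finset G) (x : ∀ t, θ.c0Action.D t) {C : ℝ} (hC : 0 ≤ C)
    (h₁ : ∀ z, ∑ t ∈ S, ‖(x t).1 z‖ ≤ C)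
    (h₂ : ∀ z, ∑ t ∈ S, ‖((θ.c0Action.α t).symm (x t)).1 z‖ ≤ C) :
    ‖ρ.π (∑ t ∈ S, FinSums.single θ.c0Action t (x t))‖ ≤ C := by
  let b : G → C₀(X, ℂ) := fun t => c0CompLeft sqrtNorm sqrtNorm_zero (x t).1
  let c : ∀ t, θ.c0Action.D t := fun t =>
    ⟨c0CompLeft divSqrtNorm divSqrtNorm_zero (x t).1, c0CompLeft_mem _ _ (x t).2⟩
  -- The phase of `x_t` goes to `c_t`, which also keeps the degree `t`, while `b_t = √|x_t|` sits in
  -- degree `1`.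
  have hbc : ∀ t, FinSums.single θ.c0Action t (x t) =
      θ.unitSingle (b t) * FinSums.single θ.c0Action t (c t) := fun t =>
    (unitSingle_mul_single _ _ _ _ fun z => sqrtNorm_mul_divSqrtNorm _).symm
  have hsum : ∀ (f : G → C₀(X, ℂ)) z, (∑ t ∈ S, f t) z = ∑ t ∈ S, f t z := fun f z =>
    map_sum (c0Eval z) f S
  simp only [hbc, map_sum, map_mul]
  refine norm_sum_mul_le_of_norm_sum_le S _ _ ?_ ?_
  · simp only [← map_star, ← map_mul, ← map_sum, unitSingle_mul_star]
    refine (norm_rep_unitSingle_le ρ _).trans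
      (ZeroAtInftyContinuousMap.norm_le_of_forall hC fun z => ?_)
    rw [hsum]
    refine (norm_sum_le_of_le _ fun t _ => ?_).trans (h₁ z)
    change ‖sqrtNorm ((x t).1 z) * star (sqrtNorm ((x t).1 z))‖ ≤ _
    rw [norm_mul, norm_star, ← sq, norm_sqrtNorm_sq]
  · simp only [← map_star, ← map_mul, star_single_mul_single, ← map_sum]
    refine (norm_rep_unitSingle_le ρ _).trans
      (ZeroAtInftyContinuousMap.norm_le_of_forall hC fun z => ?_)
    rw [hsum]
    refine (norm_sum_le_of_le _ fun t _ => ?_).trans (h₂ z)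
    by_cases hz : z ∈ θ.dom t⁻¹
    · rw [α_symm_apply _ hz, α_symm_apply _ hz]
      change ‖star (divSqrtNorm ((x t).1 (θ.h t z))) * divSqrtNorm ((x t).1 (θ.h t z))‖ ≤ _
      rw [norm_mul, norm_star, ← sq, norm_divSqrtNorm_sq]
    · have : ((θ.c0Action.α t).symm (star (c t) * c t)).1 z = 0 :=
        ((θ.c0Action.α t).symm (star (c t) * c t)).2 z hz
      rw [this, norm_zero]
      exact norm_nonneg _

end PartialAction

/-! ### Sums over orbits as sums over the group -/

theorem finsum_eq_finsum_dite_of_bijective {ι Y M : Type*} [AddCommMonoid M] {p : ι → Prop}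
    [DecidablePred p] (e : {i // p i} → Y) (he : Function.Bijective e) (F : Y → M) :
    ∑ᶠ y, F y = ∑ᶠ i, if h : p i then F (e ⟨i, h⟩) else 0 := by
  rw [← finsum_eq_of_bijective (f := fun i : {i // p i} => if h : p i then F (e ⟨i, h⟩) else 0) e he
    fun i => dif_pos i.2]
  refine (finsum_subtype_eq_finsum_cond (f := fun i => if h : p i then F (e ⟨i, h⟩) else 0) p).trans
    (finsum_congr fun i => ?_)
  by_cases h : p i
  · simp [h]
  · simp [h]

namespace PartialAction

open CStarPartialAction

variable {G : Type v} [Group G] {X : Type u} [TopologicalSpace X]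

section Fibers

variable {θ : PartialAction G X} {M : Type*} [AddCommMonoid M]

theorem rel_inv {t : G} {x : X} (hx : x ∈ θ.dom t) : θ.orbitSetoid.r x (θ.h t⁻¹ x) :=
  ⟨t⁻¹, inv_mem hx, rfl⟩

theorem rel_apply {t : G} {x : X} (hx : x ∈ θ.dom t⁻¹) : θ.orbitSetoid.r (θ.h t x) x :=
  θ.orbitSetoid.iseqv.symm ⟨t, hx, rfl⟩

-- By freeness `t ↦ h_{t⁻¹} x`, on the `t` with `x ∈ X_t`, is a bijection onto the class of `x`. The
-- inverse makes `t` the index of the sheet through `(x, h_{t⁻¹} x)`.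
open Classical in
theorem IsFree.finsum_snd (hθ : θ.IsFree) (x : X) (F : {y // θ.orbitSetoid.r x y} → M) :
    ∑ᶠ y, F y = ∑ᶠ t, if h : x ∈ θ.dom t then F ⟨θ.h t⁻¹ x, rel_inv h⟩ else 0 := by
  refine finsum_eq_finsum_dite_of_bijective
    (fun t : {t // x ∈ θ.dom t} => ⟨θ.h t.1⁻¹ x, rel_inv t.2⟩) ⟨?_, ?_⟩ F
  · intro t s h
    exact Subtype.ext (inv_injective (hθ.eq_of_apply_eq (inv_mem t.2) (inv_mem s.2)
      (congrArg Subtype.val h)))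
  · rintro ⟨_, t, ht, rfl⟩
    exact ⟨⟨t⁻¹, ht⟩, Subtype.ext (congrArg (θ.h · x) (inv_inv t))⟩

-- The pair `(h_t y, y)` lies on the same sheet `t`, so rows and columns of `R` are indexed
-- consistently by the sheets.
open Classical in
theorem IsFree.finsum_fst (hθ : θ.IsFree) (y : X) (F : {x // θ.orbitSetoid.r x y} → M) :
    ∑ᶠ x, F x = ∑ᶠ t, if h : y ∈ θ.dom t⁻¹ then F ⟨θ.h t y, rel_apply h⟩ else 0 := by
  refine finsum_eq_finsum_dite_of_bijective
    (fun t : {t // y ∈ θ.dom t⁻¹} => ⟨θ.h t.1 y, rel_apply t.2⟩) ⟨?_, ?_⟩ F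
  · intro t s h
    exact Subtype.ext (hθ.eq_of_apply_eq t.2 s.2 (congrArg Subtype.val h))
  · rintro ⟨x, t, ht, rfl⟩
    exact ⟨⟨t⁻¹, inv_mem (θ.map_mem ht)⟩, Subtype.ext (θ.inv_apply ht)⟩

end Fibers

/-! ### The sheets of `R` and the embedding of `C_c(R)` into `𝓛` -/

variable [Countable G] {θ : PartialAction G X} {hθ : θ.IsFree}
  {hσ : ∀ t, IsSigmaCompact (θ.dom t)}

theorem isLocallyConstant_orbitElt :
    IsLocallyConstant (fun γ : RelPair (θ.orbitRel hθ hσ).rel => θ.orbitElt γ) := by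
  let : TopologicalSpace G := ⊥
  have : DiscreteTopology G := ⟨rfl⟩
  have h : Topology.IsInducing
      fun γ : RelPair (θ.orbitRel hθ hσ).rel => (γ.fst, θ.orbitElt γ) := ⟨rfl⟩
  exact (IsLocallyConstant.iff_continuous _).2 (continuous_snd.comp h.continuous)

theorem continuous_fst : Continuous (RelPair.fst : RelPair (θ.orbitRel hθ hσ).rel → X) :=
  (θ.orbitRel hθ hσ).isLocalHomeomorph_fst.continuous

variable (hθ hσ) in
/-- The pair `(x, h_{t⁻¹} x)`, for `x ∈ X_t`. -/
def orbitPair (t : G) (x : θ.dom t) : RelPair (θ.orbitRel hθ hσ).rel :=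
  ⟨x, θ.h t⁻¹ x, rel_inv x.2⟩

theorem orbitElt_orbitPair (t : G) (x : θ.dom t) : θ.orbitElt (orbitPair hθ hσ t x) = t⁻¹ :=
  hθ.orbitElt_eq (orbitPair hθ hσ t x) (inv_mem x.2) rfl

theorem mem_dom_of_orbitElt_eq {γ : RelPair (θ.orbitRel hθ hσ).rel} {t : G}
    (h : θ.orbitElt γ = t⁻¹) : γ.fst ∈ θ.dom t := by
  have := θ.fst_mem γ
  rwa [h, inv_inv] at this

theorem orbitPair_fst {γ : RelPair (θ.orbitRel hθ hσ).rel} {t : G}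
    (h : θ.orbitElt γ = t⁻¹) : orbitPair hθ hσ t ⟨γ.fst, mem_dom_of_orbitElt_eq h⟩ = γ := by
  refine RelPair.ext rfl ?_
  change θ.h t⁻¹ γ.fst = γ.snd
  rw [← h]
  exact θ.h_orbitElt γ

theorem continuous_orbitPair (t : G) : Continuous (orbitPair hθ hσ t) := by
  let : TopologicalSpace G := ⊥
  have h : Topology.IsInducing
      fun γ : RelPair (θ.orbitRel hθ hσ).rel => (γ.fst, θ.orbitElt γ) := ⟨rfl⟩
  refine h.continuous_iff.2 (continuous_subtype_val.prodMk ?_)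
  exact (continuous_const (y := t⁻¹)).congr fun x => (orbitElt_orbitPair t x).symm

variable (hθ hσ) in
/-- The open and closed set of the pairs `(x, h_{t⁻¹} x)` in `R`. -/
def orbitSheet (t : G) : Set (RelPair (θ.orbitRel hθ hσ).rel) := {γ | θ.orbitElt γ = t⁻¹}

theorem isClopen_orbitSheet (t : G) : IsClopen (orbitSheet hθ hσ t) :=
  isLocallyConstant_orbitElt.isClopen_fiber t⁻¹

/-- The support of the restriction of `f` to the pairs `(x, h_{t⁻¹} x)`. -/
def sheetSupport [T2Space X] (f : (θ.orbitRel hθ hσ).ConvAlgebra) (t : G) : Set X :=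
  RelPair.fst '' (tsupport f ∩ orbitSheet hθ hσ t)

variable [T2Space X]

theorem isCompact_sheetSupport (f : (θ.orbitRel hθ hσ).ConvAlgebra) (t : G) :
    IsCompact (sheetSupport f t) :=
  (f.hasCompactSupport.isCompact.inter_right
    (isClopen_orbitSheet t).isClosed).image continuous_fst

theorem sheetSupport_subset (f : (θ.orbitRel hθ hσ).ConvAlgebra) (t : G) :
    sheetSupport f t ⊆ θ.dom t := by
  rintro _ ⟨γ, ⟨-, hγ⟩, rfl⟩
  exact mem_dom_of_orbitElt_eq hγ

theorem apply_orbitPair_eq_zero (f : (θ.orbitRel hθ hσ).ConvAlgebra) {t : G} (x : θ.dom t)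
    (hx : x.1 ∉ sheetSupport f t) : f (orbitPair hθ hσ t x) = 0 := by
  by_contra h
  exact hx ⟨_, ⟨subset_tsupport _ h, orbitElt_orbitPair t x⟩, rfl⟩

open Classical in
/-- The function `x ↦ f (x, h_{t⁻¹} x)` in `C₀(X_t)`, for `f ∈ C_c(R)`. -/
noncomputable def sheetFun (f : (θ.orbitRel hθ hσ).ConvAlgebra) (t : G) : θ.c0Action.D t :=
  ⟨{ toFun := fun x => if hx : x ∈ θ.dom t then f (orbitPair hθ hσ t ⟨x, hx⟩) else 0
     continuous_toFun := by
      rw [continuous_iff_continuousAt]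
      intro x
      by_cases hx : x ∈ θ.dom t
      · refine ContinuousOn.continuousAt ?_ ((θ.isOpen_dom t).mem_nhds hx)
        rw [continuousOn_iff_continuous_domRestrict]
        refine (f.continuous.comp (continuous_orbitPair t)).congr fun y => ?_
        rw [Set.domRestrict_apply, dif_pos y.2]
        rfl
      -- A point off `X_t` is off the compact, hence closed, set `sheetSupport f t`, so the function
      -- vanishes near it.
      · refine (continuousAt_const (y := (0 : ℂ))).congr ?_
        filter_upwards [(isCompact_sheetSupport f t).isClosed.isOpen_compl.mem_nhds
          fun h => hx (sheetSupport_subset f t h)] with y hy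
        split_ifs with h
        · exact (apply_orbitPair_eq_zero f ⟨y, h⟩ hy).symm
        · rfl
     zero_at_infty' := by
      refine tendsto_const_nhds.congr' ?_
      filter_upwards [(isCompact_sheetSupport f t).compl_mem_cocompact] with y hy
      split_ifs with h
      · exact (apply_orbitPair_eq_zero f ⟨y, h⟩ hy).symm
      · rfl },
    fun _ hx => dif_neg hx⟩

theorem sheetFun_apply (f : (θ.orbitRel hθ hσ).ConvAlgebra) {t : G} {x : X} (hx : x ∈ θ.dom t) :
    (sheetFun f t).1 x = f (orbitPair hθ hσ t ⟨x, hx⟩) := dif_pos hx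

theorem sheetFun_apply_eq_zero (f : (θ.orbitRel hθ hσ).ConvAlgebra) {t : G} {x : X}
    (hx : x ∉ sheetSupport f t) : (sheetFun f t).1 x = 0 := by
  by_cases h : x ∈ θ.dom t
  · rw [sheetFun_apply f h, apply_orbitPair_eq_zero f ⟨x, h⟩ hx]
  · exact (sheetFun f t).2 x h

/-- The support of `f` is compact and `orbitElt` is continuous into the discrete group, so it takes
finitely many values there. -/
theorem finite_sheets (f : (θ.orbitRel hθ hσ).ConvAlgebra) :
    {t | (sheetSupport f t).Nonempty}.Finite := by
  let : TopologicalSpace G := ⊥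
  have : DiscreteTopology G := ⟨rfl⟩
  have h := (f.hasCompactSupport.isCompact.image
    (isLocallyConstant_orbitElt (hθ := hθ) (hσ := hσ)).continuous).finite_of_discrete
  refine (h.image Inv.inv).subset ?_
  rintro t ⟨_, γ, ⟨hγ, hγ'⟩, rfl⟩
  exact ⟨_, ⟨γ, hγ, hγ'⟩, inv_inv t⟩

theorem sheetFun_eq_zero (f : (θ.orbitRel hθ hσ).ConvAlgebra) (t : G)
    (ht : t ∉ (finite_sheets f).toFinset) : sheetFun f t = 0 := by
  rw [Set.Finite.mem_toFinset] at ht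
  have h : sheetSupport f t = ∅ := Set.not_nonempty_iff_eq_empty.1 ht
  refine Subtype.ext (DFunLike.ext _ _ fun x => ?_)
  exact sheetFun_apply_eq_zero f (by rw [h]; exact Set.notMem_empty x)

/-- The sum `∑_t f_t δ_t` in `𝓛`, where `f_t x = f (x, h_{t⁻¹} x)`. -/
noncomputable def sheetSum (f : (θ.orbitRel hθ hσ).ConvAlgebra) : θ.c0Action.FinSums :=
  ∑ t ∈ (finite_sheets f).toFinset, FinSums.single θ.c0Action t (sheetFun f t)

theorem coeff_sheetSum (f : (θ.orbitRel hθ hσ).ConvAlgebra) (t : G) :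
    (sheetSum f).coeff t = sheetFun f t :=
  FinSums.coeff_sum_single _ (sheetFun_eq_zero f) t

theorem coeff_sheetSum_apply (f : (θ.orbitRel hθ hσ).ConvAlgebra) {t : G} {x : X}
    (hx : x ∈ θ.dom t) : ((sheetSum f).coeff t).1 x = f (orbitPair hθ hσ t ⟨x, hx⟩) := by
  rw [coeff_sheetSum, sheetFun_apply f hx]

theorem sheetSum_injective :
    Function.Injective (sheetSum : (θ.orbitRel hθ hσ).ConvAlgebra → θ.c0Action.FinSums) := by
  intro f g h
  refine DFunLike.ext _ _ fun γ => ?_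
  have h1 : θ.orbitElt γ = (θ.orbitElt γ)⁻¹⁻¹ := (inv_inv _).symm
  rw [← orbitPair_fst h1, ← coeff_sheetSum_apply, ← coeff_sheetSum_apply, h]

/-- Parametrize the intermediate point of the convolution as `y = h_{t⁻¹} z`. The pair `(z, y)` lies
on sheet `t` and `(y, h_{s⁻¹} z)` on sheet `t⁻¹ s`, which is the product formula of `𝓛`. Since
`orbitElt` reverses products, sheets are indexed by its inverse. -/
theorem sheetSum_mul (f g : (θ.orbitRel hθ hσ).ConvAlgebra) :
    sheetSum (f * g) = sheetSum f * sheetSum g := by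
  classical
  refine finSums_ext fun s z hz => ?_
  rw [coeff_mul_apply, coeff_sheetSum_apply _ hz, EtaleEquivRel.ConvAlgebra.mul_apply]
  refine (hθ.finsum_snd z _).trans (finsum_congr fun t => ?_)
  split_ifs with ht
  · have h1 : θ.h t⁻¹ z ∈ θ.dom (t⁻¹ * s) := θ.map_mem_mul (inv_mem ht) hz
    rw [coeff_sheetSum_apply _ ht, coeff_sheetSum_apply _ h1]
    congr 2
    refine RelPair.ext rfl ?_
    change θ.h s⁻¹ z = θ.h (t⁻¹ * s)⁻¹ (θ.h t⁻¹ z)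
    rw [θ.h_comp _ _ _ ⟨inv_mem ht, by simpa using hz⟩]
    simp
  · have h1 : ((sheetSum f).coeff t).1 z = 0 := ((sheetSum f).coeff t).2 z ht
    rw [h1, zero_mul]

theorem sheetSum_star (f : (θ.orbitRel hθ hσ).ConvAlgebra) :
    sheetSum (star f) = star (sheetSum f) := by
  refine finSums_ext fun s z hz => ?_
  rw [coeff_star_apply _ hz, coeff_sheetSum_apply _ hz,
    coeff_sheetSum_apply _ (θ.map_mem (inv_mem hz)), EtaleEquivRel.ConvAlgebra.star_apply]
  congr 2
  refine RelPair.ext rfl ?_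
  change z = θ.h s⁻¹⁻¹ (θ.h s⁻¹ z)
  rw [inv_inv, apply_inv hz]

variable (hθ hσ) in
/-- The embedding of `C_c(R)` into `𝓛`. -/
noncomputable def sheetHom : (θ.orbitRel hθ hσ).ConvAlgebra →⋆ₙₐ[ℂ] θ.c0Action.FinSums where
  toFun := sheetSum
  map_smul' c f := finSums_ext fun s z hz => by
    rw [FinSums.coeff_smul, coeff_sheetSum_apply _ hz]
    change _ = c • ((sheetSum f).coeff s).1 z
    rw [coeff_sheetSum_apply _ hz]
    rfl
  map_zero' := finSums_ext fun s z hz => by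
    rw [coeff_sheetSum_apply _ hz]
    rfl
  map_add' f g := finSums_ext fun s z hz => by
    rw [FinSums.coeff_add, coeff_sheetSum_apply _ hz]
    change _ = ((sheetSum f).coeff s).1 z + ((sheetSum g).coeff s).1 z
    rw [coeff_sheetSum_apply _ hz, coeff_sheetSum_apply _ hz]
    rfl
  map_mul' := sheetSum_mul
  map_star' := sheetSum_star

/-- The values `f_t z` are the entries of row `z` of `f`, one from each sheet. -/
theorem sum_norm_sheetFun_le (f : (θ.orbitRel hθ hσ).ConvAlgebra) (z : X) :
    ∑ t ∈ (finite_sheets f).toFinset, ‖(sheetFun f t).1 z‖ ≤ f.iNorm := by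
  classical
  refine le_trans (le_of_eq ?_)
    ((le_ciSup f.bddAbove_iNorm.1 z).trans (le_max_left _ _))
  refine Eq.trans ?_ (hθ.finsum_snd z _).symm
  rw [← finsum_eq_sum_of_support_subset (f := fun t => ‖(sheetFun f t).1 z‖)]
  · refine finsum_congr fun t => ?_
    split_ifs with h
    · rw [sheetFun_apply f h]; rfl
    · exact (congrArg norm ((sheetFun f t).2 z h)).trans norm_zero
  · intro t ht
    by_contra h
    refine ht ?_
    change ‖(sheetFun f t).1 z‖ = 0
    rw [sheetFun_eq_zero f t h]
    exact norm_zero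

/-- The values `f_t (h_t z) = f (h_t z, z)` are the entries of column `z`. -/
theorem sum_norm_α_symm_sheetFun_le (f : (θ.orbitRel hθ hσ).ConvAlgebra) (z : X) :
    ∑ t ∈ (finite_sheets f).toFinset, ‖((θ.c0Action.α t).symm (sheetFun f t)).1 z‖ ≤ f.iNorm := by
  classical
  refine le_trans (le_of_eq ?_)
    ((le_ciSup f.bddAbove_iNorm.2 z).trans (le_max_right _ _))
  refine Eq.trans ?_ (hθ.finsum_fst z _).symm
  rw [← finsum_eq_sum_of_support_subset
    (f := fun t => ‖((θ.c0Action.α t).symm (sheetFun f t)).1 z‖)]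
  · refine finsum_congr fun t => ?_
    split_ifs with h
    · rw [α_symm_apply _ h, sheetFun_apply f (θ.map_mem h)]
      congr 2
      exact RelPair.ext rfl (θ.inv_apply h)
    · exact (congrArg norm (((θ.c0Action.α t).symm (sheetFun f t)).2 z h)).trans norm_zero
  · intro t ht
    by_contra h
    refine ht ?_
    change ‖((θ.c0Action.α t).symm (sheetFun f t)).1 z‖ = 0
    rw [sheetFun_eq_zero f t h, map_zero]
    exact norm_zero

theorem norm_rep_sheetHom_le (ρ : BoundedRep.{max u v, w} θ.c0Action.FinSums FinSums.l1Norm)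
    (f : (θ.orbitRel hθ hσ).ConvAlgebra) : ‖ρ.π (sheetHom hθ hσ f)‖ ≤ f.iNorm := by
  refine norm_rep_sum_single_le ρ _ (sheetFun f) ?_ (sum_norm_sheetFun_le f)
    (sum_norm_α_symm_sheetFun_le f)
  exact le_max_of_le_left (Real.iSup_nonneg fun x => finsum_nonneg fun y => norm_nonneg _)

end PartialAction

/-! ### Compactly supported coefficients and density of `C_c(R)` in `𝓛` -/

theorem finsum_le_of_subsingleton_support {Y : Type*} {g : Y → ℝ} {C : ℝ} (hC : 0 ≤ C)
    (hg : (Function.support g).Subsingleton) (h : ∀ y, g y ≤ C) : ∑ᶠ y, g y ≤ C := by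
  obtain h0 | ⟨y, hy⟩ := (Function.support g).eq_empty_or_nonempty
  · rw [Function.support_eq_empty_iff.1 h0]
    exact finsum_zero.trans_le hC
  · rw [finsum_eq_single g y fun z hz => by_contra fun hz' => hz (hg hz' hy)]
    exact h y

/-- The function that multiplies `z` by `max 0 (|z| - ε) / max ε |z|`; it vanishes for `|z| ≤ ε`. -/
noncomputable def shrink (ε : ℝ) (hε : 0 < ε) : C(ℂ, ℂ) where
  toFun z := ((max 0 (‖z‖ - ε) / max ε ‖z‖ : ℝ) : ℂ) * z
  continuous_toFun := by
    refine (Complex.continuous_ofReal.comp (Continuous.div ?_ ?_ fun z => ?_)).mul continuous_id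
    · fun_prop
    · fun_prop
    · exact (lt_max_of_lt_left hε).ne'

theorem shrink_zero {ε : ℝ} (hε : 0 < ε) : shrink ε hε 0 = 0 := by simp [shrink]

theorem shrink_eq_zero {ε : ℝ} (hε : 0 < ε) {z : ℂ} (hz : ‖z‖ < ε) : shrink ε hε z = 0 := by
  change ((max 0 (‖z‖ - ε) / max ε ‖z‖ : ℝ) : ℂ) * z = 0
  rw [max_eq_left (by linarith)]
  simp

theorem norm_sub_shrink_le {ε : ℝ} (hε : 0 < ε) (z : ℂ) : ‖z - shrink ε hε z‖ ≤ ε := by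
  obtain hz | hz := lt_or_ge ‖z‖ ε
  · rw [shrink_eq_zero hε hz, sub_zero]
    exact hz.le
  · have h0 : (‖z‖ : ℂ) ≠ 0 := by
      have : 0 < ‖z‖ := hε.trans_le hz
      exact_mod_cast this.ne'
    -- For `|z| ≥ ε` the factor is `1 - ε / |z|`, so `z` moves radially by exactly `ε`.
    have h1 : z - shrink ε hε z = ((ε / ‖z‖ : ℝ) : ℂ) * z := by
      change z - ((max 0 (‖z‖ - ε) / max ε ‖z‖ : ℝ) : ℂ) * z = _
      rw [max_eq_right (by linarith), max_eq_right hz]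
      push_cast
      field_simp
      ring
    rw [h1, norm_mul, Complex.norm_real, Real.norm_of_nonneg (by positivity), div_mul_cancel₀]
    exact (hε.trans_le hz).ne'

instance CStarPartialAction.isClosed_D {G : Type v} [Group G] {A : Type u}
    [NonUnitalCStarAlgebra A] (Θ : CStarPartialAction G A) (t : G) : IsClosed (Θ.D t : Set A) :=
  Θ.isClosed t

namespace PartialAction

open CStarPartialAction

variable {G : Type v} [Group G] {X : Type u} [TopologicalSpace X] [T2Space X]

/-- The functions in `C₀(X_t)` with compact support in `X_t`. -/
noncomputable def compactPart (θ : PartialAction G X) (t : G) : Submodule ℂ (θ.c0Action.D t) where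
  carrier := {a | ∃ K : Set X, IsCompact K ∧ K ⊆ θ.dom t ∧ ∀ x, x ∉ K → a.1 x = 0}
  zero_mem' := ⟨∅, isCompact_empty, Set.empty_subset _, fun _ _ => rfl⟩
  add_mem' := by
    rintro a b ⟨K, hK, hKt, ha⟩ ⟨L, hL, hLt, hb⟩
    refine ⟨K ∪ L, hK.union hL, Set.union_subset hKt hLt, fun x hx => ?_⟩
    rw [Set.mem_union, not_or] at hx
    change a.1 x + b.1 x = 0
    rw [ha x hx.1, hb x hx.2, add_zero]
  smul_mem' := by
    rintro c a ⟨K, hK, hKt, ha⟩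
    refine ⟨K, hK, hKt, fun x hx => ?_⟩
    change c • a.1 x = 0
    rw [ha x hx, smul_zero]

/-- Composition with `shrink ε` moves values by at most `ε` and kills those of modulus below `ε`.
What survives lives on `{|a| ≥ ε}`, a compact subset of `X_t`. -/
theorem exists_mem_compactPart_norm_sub_le {θ : PartialAction G X} {t : G} (a : θ.c0Action.D t)
    {ε : ℝ} (hε : 0 < ε) : ∃ b ∈ θ.compactPart t, ‖a.1 - b.1‖ ≤ ε := by
  refine ⟨⟨c0CompLeft (shrink ε hε) (shrink_zero hε) a.1, c0CompLeft_mem _ _ a.2⟩, ?_,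
    ZeroAtInftyContinuousMap.norm_le_of_forall hε.le fun x => norm_sub_shrink_le hε _⟩
  obtain ⟨K, hK, hKt, h⟩ := exists_compact_of_mem_c0Ideal
    (OpenPartialHomeomorph.ofSet (θ.dom t) (θ.isOpen_dom t)) rfl rfl a hε
  refine ⟨K, hK, hKt, fun x hx => ?_⟩
  by_cases hxt : x ∈ θ.dom t
  · have h1 := h x hx
    rw [Set.indicator_of_mem (by exact hxt)] at h1
    exact shrink_eq_zero hε h1
  · exact c0CompLeft_mem _ (shrink_zero hε) a.2 x hxt

theorem denseRange_compactPart (θ : PartialAction G X) (t : G) :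
    DenseRange (θ.compactPart t).subtype := by
  intro a
  rw [Metric.mem_closure_range_iff]
  intro ε hε
  obtain ⟨b, hb, h⟩ := exists_mem_compactPart_norm_sub_le a (half_pos hε)
  refine ⟨⟨b, hb⟩, ?_⟩
  rw [dist_eq_norm]
  exact lt_of_le_of_lt h (half_lt_self hε)

theorem norm_mulCoeff_le {θ : PartialAction G X} (t s : G) (x : θ.c0Action.D t)
    (y : θ.c0Action.D s) : ‖θ.c0Action.mulCoeff t s x y‖ ≤ ‖x‖ * ‖y‖ := by
  change ‖(θ.c0Action.mulCoeff t s x y).1‖ ≤ _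
  refine ZeroAtInftyContinuousMap.norm_le_of_forall (by positivity) fun z => ?_
  rw [mulCoeff_apply, norm_mul]
  exact mul_le_mul (ZeroAtInftyContinuousMap.norm_apply_le x.1 _)
    (ZeroAtInftyContinuousMap.norm_apply_le y.1 _) (norm_nonneg _) (norm_nonneg _)

theorem continuous_mulCoeff {θ : PartialAction G X} (t s : G) :
    Continuous fun p : θ.c0Action.D t × θ.c0Action.D s => θ.c0Action.mulCoeff t s p.1 p.2 :=
  ((θ.c0Action.mulCoeffₗ t s).mkContinuous₂ 1 fun x y => by
    rw [one_mul]; exact norm_mulCoeff_le t s x y).continuous₂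

theorem continuous_α_symm {θ : PartialAction G X} (t : G) : Continuous (θ.c0Action.α t).symm := by
  refine AddMonoidHomClass.continuous_of_bound (θ.c0Action.α t).symm 1 fun x => ?_
  rw [one_mul]
  change ‖((θ.c0Action.α t).symm x).1‖ ≤ _
  refine ZeroAtInftyContinuousMap.norm_le_of_forall (norm_nonneg x) fun z => ?_
  by_cases hz : z ∈ θ.dom t⁻¹
  · rw [α_symm_apply _ hz]
    exact ZeroAtInftyContinuousMap.norm_apply_le x.1 _
  · exact ((congrArg norm (((θ.c0Action.α t).symm x).2 z hz)).trans norm_zero).trans_le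
      (norm_nonneg x)

theorem star_add_finSums {θ : PartialAction G X} (a b : θ.c0Action.FinSums) :
    star (a + b) = star a + star b :=
  finSums_ext fun t z hz => by
    rw [coeff_star_apply _ hz, FinSums.coeff_add, FinSums.coeff_add]
    change star ((a.coeff t⁻¹).1 (θ.h t⁻¹ z) + (b.coeff t⁻¹).1 (θ.h t⁻¹ z)) =
      ((star a).coeff t).1 z + ((star b).coeff t).1 z
    rw [coeff_star_apply _ hz, coeff_star_apply _ hz, star_add]

theorem star_zero_finSums {θ : PartialAction G X} : star (0 : θ.c0Action.FinSums) = 0 :=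
  finSums_ext fun _ _ hz => (coeff_star_apply 0 hz).trans (star_zero ℂ)

variable [Countable G] {θ : PartialAction G X} {hθ : θ.IsFree}
  {hσ : ∀ t, IsSigmaCompact (θ.dom t)}

variable (hθ hσ) in
/-- The function in `C_c(R)` supported on the pairs `(x, h_{t⁻¹} x)`, with the value `a x` there. -/
noncomputable def ofSheet (t : G) : θ.compactPart t →ₗ[ℂ] (θ.orbitRel hθ hσ).ConvAlgebra where
  toFun a := (⟨⟨(orbitSheet hθ hσ t).indicator fun γ => a.1.1 γ.fst, by
      -- The sheet is clopen, so its frontier is empty and cutting off there keeps continuity.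
      refine Continuous.indicator ?_ ((map_continuous a.1.1).comp continuous_fst)
      rw [(isClopen_orbitSheet t).frontier_eq]
      exact fun _ h => h.elim⟩, by
      obtain ⟨K, hK, hKt, h⟩ := a.2
      have hK' : IsCompact ((↑) ⁻¹' K : Set (θ.dom t)) :=
        Topology.IsInducing.subtypeVal.isCompact_preimage_iff (by simpa using hKt) |>.2 hK
      refine HasCompactSupport.intro (hK'.image (continuous_orbitPair (hθ := hθ) (hσ := hσ) t))
        fun γ hγ => ?_
      refine (Set.indicator_apply_eq_zero (f := fun γ : RelPair (θ.orbitRel hθ hσ).rel =>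
        a.1.1 γ.fst)).2 fun hγt => h _ fun hγK => hγ ?_
      exact ⟨⟨γ.fst, mem_dom_of_orbitElt_eq hγt⟩, hγK, orbitPair_fst hγt⟩⟩ :
    C_c(RelPair (θ.orbitRel hθ hσ).rel, ℂ))
  map_add' a b := DFunLike.ext _ _ fun γ => congrFun
    (Set.indicator_add (orbitSheet hθ hσ t) (fun γ => a.1.1 γ.fst) fun γ => b.1.1 γ.fst) γ
  map_smul' c a := DFunLike.ext _ _ fun γ => congrFun
    (Set.indicator_const_smul (orbitSheet hθ hσ t) c fun γ => a.1.1 γ.fst) γ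

theorem ofSheet_apply (t : G) (a : θ.compactPart t) (γ : RelPair (θ.orbitRel hθ hσ).rel) :
    ofSheet hθ hσ t a γ = (orbitSheet hθ hσ t).indicator (fun γ => a.1.1 γ.fst) γ := rfl

theorem sheetHom_ofSheet (t : G) (a : θ.compactPart t) :
    sheetHom hθ hσ (ofSheet hθ hσ t a) = FinSums.single θ.c0Action t a := by
  classical
  refine finSums_ext fun s z hz => ?_
  refine (coeff_sheetSum_apply _ hz).trans ?_
  rw [FinSums.coe_coeff_single, ofSheet_apply]
  by_cases h : s = t
  · subst h
    rw [if_pos rfl, Set.indicator_of_mem (s := orbitSheet hθ hσ s) (orbitElt_orbitPair s _)]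
    rfl
  · rw [if_neg h, Set.indicator_of_notMem]
    · rfl
    · intro h'
      exact h (inv_injective ((orbitElt_orbitPair s _).symm.trans h'))

/-- A sheet is the graph of an injective map, so it meets each row and each column of `R` in at most
one point and every sum has at most one nonzero term. -/
theorem iNorm_ofSheet_le (t : G) (a : θ.compactPart t) : (ofSheet hθ hσ t a).iNorm ≤ ‖a.1.1‖ := by
  have hle : ∀ γ, ‖ofSheet hθ hσ t a γ‖ ≤ ‖a.1.1‖ := fun γ =>
    (norm_indicator_le_norm_self (fun γ : RelPair (θ.orbitRel hθ hσ).rel => a.1.1 γ.fst) γ).trans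
      (a.1.1.norm_apply_le _)
  have hne : ∀ γ, ‖ofSheet hθ hσ t a γ‖ ≠ 0 → θ.orbitElt γ = t⁻¹ := fun γ h =>
    Set.mem_of_indicator_ne_zero (s := orbitSheet hθ hσ t) (f := fun γ => a.1.1 γ.fst)
      (norm_ne_zero_iff.1 h)
  refine max_le (Real.iSup_le (fun x => ?_) (norm_nonneg _))
    (Real.iSup_le (fun y => ?_) (norm_nonneg _))
  · refine finsum_le_of_subsingleton_support (norm_nonneg _) ?_ fun y => hle _
    intro y hy y' hy'
    have h := congrArg RelPair.snd (orbitPair_fst (hne _ hy))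
    have h' := congrArg RelPair.snd (orbitPair_fst (hne _ hy'))
    exact Subtype.ext (h.symm.trans h')
  · refine finsum_le_of_subsingleton_support (norm_nonneg _) ?_ fun x => hle _
    have key : ∀ x : {x // θ.orbitSetoid.r x y}, ‖ofSheet hθ hσ t a ⟨x, y, x.2⟩‖ ≠ 0 →
        x.1 = θ.h t y := fun x hx => by
      have h := congrArg RelPair.snd (orbitPair_fst (hne _ hx))
      have h2 := apply_inv (mem_dom_of_orbitElt_eq (hne _ hx))
      exact h2.symm.trans (congrArg (θ.h t) h)
    intro x hx x' hx'
    exact Subtype.ext ((key x hx).trans (key x' hx').symm)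

theorem sheetFun_mem (f : (θ.orbitRel hθ hσ).ConvAlgebra) (t : G) :
    sheetFun f t ∈ θ.compactPart t :=
  ⟨sheetSupport f t, isCompact_sheetSupport f t, sheetSupport_subset f t,
    fun _ hx => sheetFun_apply_eq_zero f hx⟩

/-- Both sides have the same image in `𝓛`, where the identity is the expansion into coefficients. It
reduces statements on `C_c(R)` to functions on one sheet. -/
theorem sum_ofSheet_sheetFun (f : (θ.orbitRel hθ hσ).ConvAlgebra) :
    ∑ t ∈ (finite_sheets f).toFinset, ofSheet hθ hσ t ⟨sheetFun f t, sheetFun_mem f t⟩ = f := by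
  refine sheetSum_injective ?_
  change sheetHom hθ hσ _ = sheetSum f
  rw [map_sum]
  exact Finset.sum_congr rfl fun t _ => sheetHom_ofSheet t _

theorem exists_l1Norm_sub_sheetHom_lt (b : θ.c0Action.FinSums) :
    ∀ ε > 0, ∃ f : (θ.orbitRel hθ hσ).ConvAlgebra, FinSums.l1Norm (b - sheetHom hθ hσ f) < ε := by
  induction b using FinSums.induction_on with
  | h0 =>
    intro ε hε
    refine ⟨0, ?_⟩
    -- Zero is written as a single term so that `l1Norm_single` applies.
    have h : (0 : θ.c0Action.FinSums) - sheetHom hθ hσ 0 = FinSums.single θ.c0Action 1 0 := by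
      rw [map_zero, map_zero, sub_zero]
    rw [h, FinSums.l1Norm_single]
    exact (norm_zero (E := C₀(X, ℂ))).trans_lt hε
  | hs t x =>
    intro ε hε
    obtain ⟨y, hy, h⟩ := exists_mem_compactPart_norm_sub_le x (half_pos hε)
    refine ⟨ofSheet hθ hσ t ⟨y, hy⟩, ?_⟩
    rw [sheetHom_ofSheet, ← map_sub, FinSums.l1Norm_single]
    exact h.trans_lt (half_lt_self hε)
  | hadd a b ha hb =>
    intro ε hε
    obtain ⟨f, hf⟩ := ha _ (half_pos hε)
    obtain ⟨g, hg⟩ := hb _ (half_pos hε)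
    refine ⟨f + g, ?_⟩
    rw [map_add, add_sub_add_comm]
    exact (FinSums.l1Norm_add_le _ _).trans_lt (by linarith)

/-! ### Extension of representations from `C_c(R)` to `𝓛` -/

section Extension

variable (π : BoundedRep.{u, w} (θ.orbitRel hθ hσ).ConvAlgebra EtaleEquivRel.ConvAlgebra.iNorm)

/-- The extension of a representation of `C_c(R)` to the coefficients in `C₀(X_t)`. -/
noncomputable def extendCoeff (t : G) : θ.c0Action.D t →L[ℂ] (π.H →L[ℂ] π.H) :=
  ((π.π : _ →ₗ[ℂ] (π.H →L[ℂ] π.H)) ∘ₗ ofSheet hθ hσ t).extendOfNorm (θ.compactPart t).subtype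

theorem norm_rep_ofSheet_le (t : G) (a : θ.compactPart t) :
    ‖((π.π : _ →ₗ[ℂ] (π.H →L[ℂ] π.H)) ∘ₗ ofSheet hθ hσ t) a‖ ≤
      1 * ‖(θ.compactPart t).subtype a‖ := by
  rw [one_mul]
  exact (π.bound _).trans (iNorm_ofSheet_le t a)

theorem extendCoeff_coe (t : G) (a : θ.compactPart t) :
    extendCoeff π t a = π.π (ofSheet hθ hσ t a) :=
  LinearMap.extendOfNorm_eq (denseRange_compactPart θ t) ⟨1, norm_rep_ofSheet_le π t⟩ a

theorem norm_extendCoeff_le (t : G) (a : θ.c0Action.D t) : ‖extendCoeff π t a‖ ≤ ‖a.1‖ := by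
  have h := LinearMap.norm_extendOfNorm_apply_le (denseRange_compactPart θ t) 1
    (norm_rep_ofSheet_le π t) a
  rwa [one_mul] at h

open Classical in
/-- The extension of a representation of `C_c(R)` to `𝓛`, as a linear map. -/
noncomputable def extendLin : θ.c0Action.FinSums →ₗ[ℂ] (π.H →L[ℂ] π.H) :=
  DFinsupp.lsum ℂ fun t => (extendCoeff π t : θ.c0Action.D t →ₗ[ℂ] (π.H →L[ℂ] π.H))

theorem extendLin_single (t : G) (a : θ.c0Action.D t) :
    extendLin π (FinSums.single θ.c0Action t a) = extendCoeff π t a := by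
  classical
  exact DFinsupp.lsum_single _ _ _ _

/-- After `f` is split into sheets, this is `extendCoeff_coe` on each of them. It shows that
`extendLin π` really extends `π`, which carries identities over from `C_c(R)`. -/
theorem extendLin_sheetHom (f : (θ.orbitRel hθ hσ).ConvAlgebra) :
    extendLin π (sheetHom hθ hσ f) = π.π f := by
  conv_lhs => rw [← sum_ofSheet_sheetFun f]
  conv_rhs => rw [← sum_ofSheet_sheetFun f]
  simp only [map_sum, sheetHom_ofSheet, extendLin_single]
  exact Finset.sum_congr rfl fun t _ => extendCoeff_coe π t ⟨sheetFun f t, sheetFun_mem f t⟩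

theorem extendLin_single_mul_single (t s : G) (a : θ.c0Action.D t) (b : θ.c0Action.D s) :
    extendLin π (FinSums.single θ.c0Action t a * FinSums.single θ.c0Action s b) =
      extendLin π (FinSums.single θ.c0Action t a) * extendLin π (FinSums.single θ.c0Action s b) := by
  suffices h : ∀ q : θ.c0Action.D t × θ.c0Action.D s,
      extendLin π (FinSums.single θ.c0Action t q.1 * FinSums.single θ.c0Action s q.2) =
        extendLin π (FinSums.single θ.c0Action t q.1) *
          extendLin π (FinSums.single θ.c0Action s q.2) from h (a, b)
  -- Both sides are jointly continuous in the two coefficients, so compactly supported ones suffice.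
  -- Those come from `C_c(R)`, where `π` is multiplicative.
  have hd := (denseRange_compactPart θ t).prodMap (denseRange_compactPart θ s)
  refine isClosed_property hd ?_ ?_
  · simp only [FinSums.single_mul_single, extendLin_single]
    exact isClosed_eq ((extendCoeff π _).continuous.comp (continuous_mulCoeff t s))
      (((extendCoeff π t).continuous.comp _root_.continuous_fst).mul
        ((extendCoeff π s).continuous.comp _root_.continuous_snd))
  · rintro ⟨a, b⟩
    simp only [Prod.map_fst, Prod.map_snd, Submodule.subtype_apply]
    rw [← sheetHom_ofSheet (hθ := hθ) (hσ := hσ), ← sheetHom_ofSheet (hθ := hθ) (hσ := hσ),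
      ← map_mul, extendLin_sheetHom, extendLin_sheetHom, extendLin_sheetHom, map_mul]

theorem extendLin_star_single (t : G) (a : θ.c0Action.D t) :
    extendLin π (star (FinSums.single θ.c0Action t a)) =
      star (extendLin π (FinSums.single θ.c0Action t a)) := by
  refine (denseRange_compactPart θ t).induction_on
    (p := fun a => extendLin π (star (FinSums.single θ.c0Action t a)) =
      star (extendLin π (FinSums.single θ.c0Action t a))) a ?_ fun a => ?_
  · simp only [star_single, extendLin_single]
    exact isClosed_eq ((extendCoeff π _).continuous.comp
      ((continuous_α_symm t).comp continuous_star)) (extendCoeff π t).continuous.star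
  · rw [Submodule.subtype_apply, ← sheetHom_ofSheet (hθ := hθ) (hσ := hσ), ← map_star,
      extendLin_sheetHom, extendLin_sheetHom, map_star]

/-- The extension of a representation of `C_c(R)` to `𝓛`. -/
noncomputable def extendRep : BoundedRep.{max u v, w} θ.c0Action.FinSums FinSums.l1Norm where
  H := π.H
  π :=
    { extendLin π with
      map_zero' := map_zero (extendLin π)
      map_mul' := fun a b => by
        change extendLin π (a * b) = extendLin π a * extendLin π b
        induction a using FinSums.induction_on with
        | h0 => rw [zero_mul, map_zero, zero_mul]
        | hadd a a' ha ha' => rw [add_mul, map_add, map_add, ha, ha', add_mul]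
        | hs t x =>
          induction b using FinSums.induction_on with
          | h0 => rw [mul_zero, map_zero, mul_zero]
          | hadd b b' hb hb' => rw [mul_add, map_add, map_add, hb, hb', mul_add]
          | hs s y => exact extendLin_single_mul_single π t s x y
      map_star' := fun a => by
        change extendLin π (star a) = star (extendLin π a)
        induction a using FinSums.induction_on with
        | h0 => rw [star_zero_finSums, map_zero, star_zero]
        | hadd a a' ha ha' => rw [star_add_finSums, map_add, map_add, ha, ha', star_add]
        | hs t x => exact extendLin_star_single π t x }
  bound := FinSums.norm_apply_le_l1Norm (extendLin π) fun t x => by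
    rw [extendLin_single]
    exact norm_extendCoeff_le π t x

end Extension

end PartialAction

/-- For a free partial action of a countable group `G` on a locally compact Hausdorff space `X` with
`σ`-compact domains `X_t`, the partial crossed product of `C₀(X)` by `G` is isomorphic to the full
groupoid C*-algebra of the orbit equivalence relation. Both C*-algebras are formed with Hilbert
spaces in the universe `max u v`, which is at least that of `𝓛` and of `C_c(R)`. -/
theorem mainTheorem3 {G : Type v} [Group G] [Countable G] {X : Type u} [TopologicalSpace X]
    [T2Space X] [LocallyCompactSpace X] (θ : PartialAction G X) (hθ : θ.IsFree)
    (hσ : ∀ t, IsSigmaCompact (θ.dom t)) :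
    Nonempty (CStarPartialAction.CrossedProduct.{u, v, max u v} θ.c0Action ≃⋆ₐ[ℂ]
      EtaleEquivRel.FullCStarAlgebra.{u, max u v} (θ.orbitRel hθ hσ)) :=
  -- The induced map goes from `C^*(R)` to the crossed product, in the direction of `sheetHom`,
  -- hence the final `symm`.
  ⟨(StarAlgEquiv.ofBijective
    (EnvelopingCStarAlgebra.map.{u, max u v, max u v} (PartialAction.sheetHom hθ hσ)
      PartialAction.norm_rep_sheetHom_le)
    (EnvelopingCStarAlgebra.map_bijective _ _
      (fun π => ⟨PartialAction.extendRep π, fun f =>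
        (congrArg norm (PartialAction.extendLin_sheetHom π f)).ge⟩)
      PartialAction.exists_l1Norm_sub_sheetHom_lt)).symm⟩
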